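/- **Theorem (a simultaneous matching can be found in polynomial time on an overlapping convex bipartite graph).** An *overlapping bipartite graph* is a finite bipartite graph $G=\langle A\cup B,E\rangle$, $A\cap B=\emptyset$, $E\subseteq A\times B$, together with two sets $S,T$ such that $A=S\cup T$ and $S\cap T\neq\emptyset$. A *matching that covers* $P\subseteq A$ is a set of pairwise non-adjacent edges such that every vertex of $P$ is incident to exactly one of them. A *simultaneous matching* is a set $M\subseteq E$ such that $M\cap(S\times B)$ and $M\cap(T\times B)$ are matchings that cover $S$ and $T$, respectively. Let $B=\{1,\dots,d\}$ with its natural order; $G$ is *convex* if the neighborhood $N(u)=\{v\in B : (u,v)\in E\}$ of every $u\in A$ is an interval of $B$ (possibly empty). There are a single deterministic algorithm and a polynomial $p$ such that, for all $n,d\ge 0$ and every overlapping convex bipartite graph with $|A|=n$ and $B=\{1,\dots,d\}$, given by $n$, $d$, the characteristic vectors of $S$ and $T$ and the adjacency matrix of $E$, the algorithm halts after at most $p(n+d)$ steps and correctly reports whether a simultaneous matching exists and, if one exists, outputs a simultaneous matching. (Steps are counted on a random access machine with registers and arrays of natural numbers, with addition, truncated subtraction, indirect addressing and tests for zero at unit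 cost; for this machine model polynomial time coincides with polynomial time on Turing machines.) -/

import Mathlib

/-! ### Overlapping bipartite graphs and simultaneous matchings -/

/-- An overlapping bipartite graph with classes `A = Fin n` and `B = Fin d` (disjoint copies, so
`A ∩ B = ∅` is automatic), edge set `E ⊆ A × B`, and two sets `S`, `T` with `A = S ∪ T` and
`S ∩ T ≠ ∅`. -/
structure OverlappingBipartiteGraph (n d : ℕ) where
  E : Finset (Fin n × Fin d)
  S : Finset (Fin n)
  T : Finset (Fin n)
  union_eq : S ∪ T = Finset.univ
  inter_nonempty : (S ∩ T).Nonempty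

namespace OverlappingBipartiteGraph

variable {n d : ℕ}

/-- The neighbourhood of a vertex of `A`. -/
def nbhd (G : OverlappingBipartiteGraph n d) (u : Fin n) : Set (Fin d) :=
  {v | (u, v) ∈ G.E}

/-- The graph is convex: every neighbourhood of a vertex of `A` is an interval (possibly empty) of
the linearly ordered class `B`. -/
def IsConvex (G : OverlappingBipartiteGraph n d) : Prop :=
  ∀ u, (G.nbhd u).OrdConnected

/-- `M` is a set of pairwise non-adjacent edges such that every vertex of `P` is incident to exactly
one edge of `M`. -/
def IsMatchingCovering (M : Finset (Fin n × Fin d)) (P : Finset (Fin n)) : Prop :=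
  (∀ e ∈ M, ∀ f ∈ M, e ≠ f → e.1 ≠ f.1 ∧ e.2 ≠ f.2) ∧ ∀ u ∈ P, ∃! e, e ∈ M ∧ e.1 = u

/-- `M` is a simultaneous matching: `M ⊆ E`, and `M ∩ (S × B)` and `M ∩ (T × B)` are matchings
that cover `S` and `T`, respectively. -/
def IsSimultaneousMatching (G : OverlappingBipartiteGraph n d) (M : Finset (Fin n × Fin d)) :
    Prop :=
  M ⊆ G.E ∧
    IsMatchingCovering (M ∩ (G.S ×ˢ Finset.univ)) G.S ∧
    IsMatchingCovering (M ∩ (G.T ×ˢ Finset.univ)) G.T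

end OverlappingBipartiteGraph

/-! ### Random access programs with a step count

Structured programs over natural-number registers and arrays with indirect addressing. The only
arithmetic is addition and truncated subtraction, so within `t` steps numbers grow to `O(t)` more
bits only, and polynomial time with unit cost per instruction is the usual polynomial time. -/

namespace Ram

/-- A memory: `reg x` is the content of register `x`, and `arr a i` is cell `i` of array `a`. -/
@[ext]
structure State where
  reg : ℕ → ℕ
  arr : ℕ → ℕ → ℕ

/-- `s` with register `x` set to `v`. -/
def State.setReg (s : State) (x v : ℕ) : State :=
  { s with reg := Function.update s.reg x v }

/-- `s` with cell `i` of array `a` set to `v`. -/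
def State.setArr (s : State) (a i v : ℕ) : State :=
  { s with arr := Function.update s.arr a (Function.update (s.arr a) i v) }

/-- Programs. Register names, array names and constants are fixed in the program text. -/
inductive Cmd where
  | skip : Cmd
  /-- `reg x := c` -/
  | const (x c : ℕ) : Cmd
  /-- `reg x := reg y + reg z` -/
  | add (x y z : ℕ) : Cmd
  /-- `reg x := reg y - reg z`, truncated at `0` -/
  | sub (x y z : ℕ) : Cmd
  /-- `reg x := arr a (reg y)` -/
  | load (x a y : ℕ) : Cmd
  /-- `arr a (reg x) := reg y` -/
  | store (a x y : ℕ) : Cmd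
  | seq (p q : Cmd) : Cmd
  /-- if `reg x ≠ 0` then `p` else `q` -/
  | cond (x : ℕ) (p q : Cmd) : Cmd
  /-- while `reg x ≠ 0` do `p` -/
  | loop (x : ℕ) (p : Cmd) : Cmd

/-- `Exec p s s' t`: started in the memory `s`, the program `p` halts in the memory `s'` after
exactly `t` steps. Every instruction and every test of a register costs one step. -/
inductive Exec : Cmd → State → State → ℕ → Prop where
  | skip (s : State) : Exec Cmd.skip s s 1
  | const (s : State) (x c : ℕ) : Exec (Cmd.const x c) s (s.setReg x c) 1
  | add (s : State) (x y z : ℕ) :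
      Exec (Cmd.add x y z) s (s.setReg x (s.reg y + s.reg z)) 1
  | sub (s : State) (x y z : ℕ) :
      Exec (Cmd.sub x y z) s (s.setReg x (s.reg y - s.reg z)) 1
  | load (s : State) (x a y : ℕ) :
      Exec (Cmd.load x a y) s (s.setReg x (s.arr a (s.reg y))) 1
  | store (s : State) (a x y : ℕ) :
      Exec (Cmd.store a x y) s (s.setArr a (s.reg x) (s.reg y)) 1
  | seq {p q : Cmd} {s s' s'' : State} {t t' : ℕ} :
      Exec p s s' t → Exec q s' s'' t' → Exec (Cmd.seq p q) s s'' (t + t')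
  | cond_true {x : ℕ} {p q : Cmd} {s s' : State} {t : ℕ} :
      s.reg x ≠ 0 → Exec p s s' t → Exec (Cmd.cond x p q) s s' (t + 1)
  | cond_false {x : ℕ} {p q : Cmd} {s s' : State} {t : ℕ} :
      s.reg x = 0 → Exec q s s' t → Exec (Cmd.cond x p q) s s' (t + 1)
  | loop_step {x : ℕ} {p : Cmd} {s s' s'' : State} {t t' : ℕ} :
      s.reg x ≠ 0 → Exec p s s' t → Exec (Cmd.loop x p) s' s'' t' →
        Exec (Cmd.loop x p) s s'' (t + t' + 1)
  | loop_done {x : ℕ} {p : Cmd} {s : State} :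
      s.reg x = 0 → Exec (Cmd.loop x p) s s 1

/-- Programs are deterministic: the final memory and the number of steps are functions of the
program and the initial memory. -/
theorem Exec.deterministic {p : Cmd} {s s₁ s₂ : State} {t₁ t₂ : ℕ}
    (h₁ : Exec p s s₁ t₁) (h₂ : Exec p s s₂ t₂) : s₁ = s₂ ∧ t₁ = t₂ := by
  induction h₁ generalizing s₂ t₂ with
  | skip => cases h₂; exact ⟨rfl, rfl⟩
  | const => cases h₂; exact ⟨rfl, rfl⟩
  | add => cases h₂; exact ⟨rfl, rfl⟩
  | sub => cases h₂; exact ⟨rfl, rfl⟩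
  | load => cases h₂; exact ⟨rfl, rfl⟩
  | store => cases h₂; exact ⟨rfl, rfl⟩
  | seq _ _ ih ih' =>
    cases h₂ with
    | seq a b =>
      obtain ⟨rfl, rfl⟩ := ih a
      obtain ⟨rfl, rfl⟩ := ih' b
      exact ⟨rfl, rfl⟩
  | cond_true hx _ ih =>
    cases h₂ with
    | cond_true _ a => obtain ⟨rfl, rfl⟩ := ih a; exact ⟨rfl, rfl⟩
    | cond_false hx' _ => exact absurd hx' hx
  | cond_false hx _ ih =>
    cases h₂ with
    | cond_true hx' _ => exact absurd hx hx'
    | cond_false _ a => obtain ⟨rfl, rfl⟩ := ih a; exact ⟨rfl, rfl⟩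
  | loop_step hx _ _ ih ih' =>
    cases h₂ with
    | loop_step _ a b =>
      obtain ⟨rfl, rfl⟩ := ih a
      obtain ⟨rfl, rfl⟩ := ih' b
      exact ⟨rfl, rfl⟩
    | loop_done hx' => exact absurd hx' hx
  | loop_done hx =>
    cases h₂ with
    | loop_step hx' _ _ => exact absurd hx hx'
    | loop_done _ => exact ⟨rfl, rfl⟩

end Ram

/-! ### Input and output conventions -/

namespace OverlappingBipartiteGraph

variable {n d : ℕ}

/-- The input memory for `G`: registers `0` and `1` hold `n` and `d`; arrays `0` and `1` are the
characteristic functions of `S` and `T`; array `2` is the adjacency matrix in row-major order (the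
pair `(u, v)` at address `u * d + v`). Everything else is `0`. -/
def input (G : OverlappingBipartiteGraph n d) : Ram.State where
  reg x := if x = 0 then n else if x = 1 then d else 0
  arr a k :=
    if a = 0 then (if ∃ u ∈ G.S, (u : ℕ) = k then 1 else 0)
    else if a = 1 then (if ∃ u ∈ G.T, (u : ℕ) = k then 1 else 0)
    else if a = 2 then (if ∃ e ∈ G.E, (e.1 : ℕ) * d + (e.2 : ℕ) = k then 1 else 0)
    else 0

/-- The set of pairs whose characteristic matrix is left in array `3`, in row-major order. -/
def outputEdges (n d : ℕ) (s : Ram.State) : Finset (Fin n × Fin d) :=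
  Finset.univ.filter fun e => s.arr 3 ((e.1 : ℕ) * d + (e.2 : ℕ)) = 1

/-- The final memory `s` answers the simultaneous matching problem for `G`: register `0` holds `1`
if a simultaneous matching exists and `0` if not, and in the first case array `3` holds one. -/
def IsAnswer (G : OverlappingBipartiteGraph n d) (s : Ram.State) : Prop :=
  (s.reg 0 = 1 ∧ G.IsSimultaneousMatching (outputEdges n d s)) ∨
    (s.reg 0 = 0 ∧ ¬ ∃ M, G.IsSimultaneousMatching M)

end OverlappingBipartiteGraph

/-! By convexity each vertex of `A` is a unit job with a window `[lo u, hi u)` of slots, and a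
simultaneous matching is a choice of slots that is injective on `S` and on `T`. Jobs of `S \ T` and
of `T \ S` may share slots, but neither may share with `S ∩ T`. So a schedule amounts to a set `Z`
of slots such that `S \ T` and `T \ S` can each be placed injectively in `Z`, and `S ∩ T` in its
complement.

For windows, Hall's condition need only be checked on intervals. In terms of the prefix counts `t v
= |Z ∩ [0, v)|` it becomes a system of difference constraints, two for each pair `a ≤ b`. The unit
intervals force the increments of `t` to be 0 or 1, so every solution comes from some `Z`
(`IsSchedule.exists_isPotential`, `IsPotential.exists_isSchedule`).

The system is solved by relaxation from `t = 0`. Raising values only as far as the constraints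
demand keeps `t` below every solution. If there is one, there is one with values at most `d`, so the
sum of the `d + 1` values never exceeds `d * (d + 1)`. A round that changes something raises this
sum, and a round that changes nothing certifies a solution. Hence `(d + 1) ^ 2` rounds decide
feasibility (`test_run`).

A schedule is then found by self-reduction: lower ends of windows are raised one slot at a time as
long as a schedule remains, until every schedule must use the lower ends (`narrow_run`).

All of this is written in a language whose loops have bounds `n`, `d` or `d + 1` in registers that
are never written. Termination and the polynomial bound then follow from syntax alone (`exec`), and
correctness concerns only the function `run`. -/

/-! ### Programs with counted loops -/

namespace Ram

/-- Programs whose only loops are counted: `rep i b p` runs `p` with register `i` equal to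
`0, 1, …, reg b - 1`. -/
inductive Prog where
  | skip : Prog
  | const (x c : ℕ) : Prog
  | add (x y z : ℕ) : Prog
  | sub (x y z : ℕ) : Prog
  | load (x a y : ℕ) : Prog
  | store (a x y : ℕ) : Prog
  | seq (p q : Prog) : Prog
  | cond (x : ℕ) (p q : Prog) : Prog
  | rep (i b : ℕ) (p : Prog) : Prog

namespace Prog

scoped infixr:60 " ;; " => Prog.seq

/-- Translation to random access programs. Registers `3` and `4` serve the loop control. -/
def toCmd : Prog → Cmd
  | skip => .skip
  | const x c => .const x c
  | add x y z => .add x y z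
  | sub x y z => .sub x y z
  | load x a y => .load x a y
  | store a x y => .store a x y
  | seq p q => .seq p.toCmd q.toCmd
  | cond x p q => .cond x p.toCmd q.toCmd
  | rep i b p => .seq (.const i 0) (.seq (.sub 4 b i)
      (.loop 4 (.seq p.toCmd (.seq (.const 3 1) (.seq (.add i i 3) (.sub 4 b i))))))

/-- The loop control at the end of an iteration. -/
def next (i b : ℕ) (s : State) : State :=
  let s' := (s.setReg 3 1).setReg i (s.reg i + 1)
  s'.setReg 4 (s'.reg b - s'.reg i)

/-- The final memory. -/
def run : Prog → State → State
  | skip, s => s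
  | const x c, s => s.setReg x c
  | add x y z, s => s.setReg x (s.reg y + s.reg z)
  | sub x y z, s => s.setReg x (s.reg y - s.reg z)
  | load x a y, s => s.setReg x (s.arr a (s.reg y))
  | store a x y, s => s.setArr a (s.reg x) (s.reg y)
  | seq p q, s => q.run (p.run s)
  | cond x p q, s => if s.reg x ≠ 0 then p.run s else q.run s
  | rep i b p, s => (fun s => next i b (p.run s))^[s.reg b] ((s.setReg i 0).setReg 4 (s.reg b))

/-- Whether register `r` occurs as a target. -/
def writesReg : Prog → ℕ → Bool
  | skip, _ => false
  | const x _, r => r == x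
  | add x _ _, r => r == x
  | sub x _ _, r => r == x
  | load x _ _, r => r == x
  | store _ _ _, _ => false
  | seq p q, r => p.writesReg r || q.writesReg r
  | cond _ p q, r => p.writesReg r || q.writesReg r
  | rep i _ p, r => r == i || r == 3 || r == 4 || p.writesReg r

/-- Whether array `a` occurs as a target. -/
def writesArr : Prog → ℕ → Bool
  | store a _ _, r => r == a
  | seq p q, r => p.writesArr r || q.writesArr r
  | cond _ p q, r => p.writesArr r || q.writesArr r
  | rep _ _ p, r => p.writesArr r
  | _, _ => false

/-- Registers `0`, `1`, `2` are never written, only they bound loops, and no loop body writes the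
loop counter. -/
def wf : Prog → Bool
  | skip => true
  | const x _ => 3 ≤ x
  | add x _ _ => 3 ≤ x
  | sub x _ _ => 3 ≤ x
  | load x _ _ => 3 ≤ x
  | store _ _ _ => true
  | seq p q => p.wf && q.wf
  | cond _ p q => p.wf && q.wf
  | rep i b p => 5 ≤ i && b < 3 && !p.writesReg i && p.wf

/-- A bound for the number of steps in terms of a bound for registers `0`, `1`, `2`. -/
noncomputable def time : Prog → Polynomial ℕ
  | seq p q => p.time + q.time
  | cond _ p q => p.time + q.time + 1
  | rep _ _ p => Polynomial.X * (p.time + 4) + 3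
  | _ => 1

/-! ### Frame properties, running time and the loop rule -/

theorem run_reg (p : Prog) (s : State) {x : ℕ} (h : p.writesReg x = false) :
    (p.run s).reg x = s.reg x := by
  induction p generalizing s with
  | skip | store => rfl
  | const | add | sub | load =>
    simp only [writesReg, beq_eq_false_iff_ne] at h
    simp [run, State.setReg, h]
  | seq p q ihp ihq =>
    simp only [writesReg, Bool.or_eq_false_iff] at h
    simp [run, ihp, ihq, h]
  | cond y p q ihp ihq =>
    simp only [writesReg, Bool.or_eq_false_iff] at h
    simp only [run]
    split_ifs <;> simp [ihp, ihq, h]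
  | rep i b p ih =>
    simp only [writesReg, Bool.or_eq_false_iff, beq_eq_false_iff_ne] at h
    obtain ⟨⟨⟨h1, h2⟩, h3⟩, h4⟩ := h
    have key : ∀ m s, ((fun s => next i b (p.run s))^[m] s).reg x = s.reg x := by
      intro m
      induction m with
      | zero => intro s; rfl
      | succ m ihm =>
        intro s
        rw [Function.iterate_succ_apply, ihm, ← ih s h4]
        simp [next, State.setReg, h1, h2, h3]
    simp [run, key, State.setReg, h1, h3]

theorem run_arr (p : Prog) (s : State) {a : ℕ} (h : p.writesArr a = false) :
    (p.run s).arr a = s.arr a := by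
  induction p generalizing s with
  | skip | const | add | sub | load => rfl
  | store =>
    simp only [writesArr, beq_eq_false_iff_ne] at h
    simp [run, State.setArr, h]
  | seq p q ihp ihq =>
    simp only [writesArr, Bool.or_eq_false_iff] at h
    simp [run, ihp, ihq, h]
  | cond y p q ihp ihq =>
    simp only [writesArr, Bool.or_eq_false_iff] at h
    simp only [run]
    split_ifs <;> simp [ihp, ihq, h]
  | rep i b p ih =>
    have key : ∀ m s, ((fun s => next i b (p.run s))^[m] s).arr a = s.arr a := by
      intro m
      induction m with
      | zero => intro s; rfl
      | succ m ihm =>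
        intro s
        rw [Function.iterate_succ_apply, ihm, ← ih s h]
        rfl
    simp [run, key, State.setReg]

theorem writesReg_of_wf {p : Prog} (h : p.wf = true) {x : ℕ} (hx : x < 3) :
    p.writesReg x = false := by
  induction p <;> simp_all [wf, writesReg] <;> omega

/-- Well-formed programs halt within the time bound. -/
theorem exec {p : Prog} (h : p.wf = true) {N : ℕ} (s : State) (hN : ∀ x < 3, s.reg x ≤ N) :
    ∃ t ≤ p.time.eval N, Exec p.toCmd s (p.run s) t := by
  induction p generalizing s with
  | skip => exact ⟨1, by simp [time], .skip s⟩
  | const x c => exact ⟨1, by simp [time], .const s x c⟩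
  | add x y z => exact ⟨1, by simp [time], .add s x y z⟩
  | sub x y z => exact ⟨1, by simp [time], .sub s x y z⟩
  | load x a y => exact ⟨1, by simp [time], .load s x a y⟩
  | store a x y => exact ⟨1, by simp [time], .store s a x y⟩
  | seq p q ihp ihq =>
    simp only [wf, Bool.and_eq_true] at h
    obtain ⟨t, ht, e⟩ := ihp h.1 s hN
    obtain ⟨t', ht', e'⟩ := ihq h.2 (p.run s) fun x hx => by
      rw [run_reg p s (writesReg_of_wf h.1 hx)]; exact hN x hx
    exact ⟨t + t', by simp only [time, Polynomial.eval_add]; omega, .seq e e'⟩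
  | cond x p q ihp ihq =>
    simp only [wf, Bool.and_eq_true] at h
    by_cases hx : s.reg x = 0
    · obtain ⟨t, ht, e⟩ := ihq h.2 s hN
      refine ⟨t + 1, by simp only [time, Polynomial.eval_add, Polynomial.eval_one]; omega, ?_⟩
      simpa [run, toCmd, hx] using Exec.cond_false hx e
    · obtain ⟨t, ht, e⟩ := ihp h.1 s hN
      refine ⟨t + 1, by simp only [time, Polynomial.eval_add, Polynomial.eval_one]; omega, ?_⟩
      simpa [run, toCmd, hx] using Exec.cond_true hx e
  | rep i b p ih =>
    simp only [wf, Bool.and_eq_true, Bool.not_eq_true', decide_eq_true_eq] at h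
    obtain ⟨⟨⟨hi, hb⟩, hpi⟩, hp⟩ := h
    have key : ∀ m s, s.reg 4 = m → s.reg b = s.reg i + m → (∀ x < 3, s.reg x ≤ N) →
        ∃ t ≤ m * (p.time.eval N + 4) + 1,
          Exec (.loop 4 (.seq p.toCmd (.seq (.const 3 1) (.seq (.add i i 3) (.sub 4 b i))))) s
            ((fun s => next i b (p.run s))^[m] s) t := by
      intro m
      induction m with
      | zero => intro s h4 _ _; exact ⟨1, by omega, .loop_done h4⟩
      | succ m ihm =>
        intro s h4 hbi hN
        obtain ⟨t, ht, e⟩ := ih hp s hN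
        -- Nested loops may overwrite registers 3 and 4. The remaining count is recomputed from the
        -- bound and the counter, which the body leaves alone.
        have hb' : (p.run s).reg b = s.reg b := run_reg p s (writesReg_of_wf hp hb)
        have hi' : (p.run s).reg i = s.reg i := run_reg p s hpi
        have hnext : ∀ x < 3, (next i b (p.run s)).reg x = s.reg x := fun x hx => by
          rw [← run_reg p s (writesReg_of_wf hp hx)]
          have h1 : x ≠ i := by omega
          have h2 : x ≠ 3 := by omega
          have h3 : x ≠ 4 := by omega
          simp [next, State.setReg, h1, h2, h3]
        have hbi' : b ≠ i := by omega
        have hb3 : b ≠ 3 := by omega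
        have hi4 : i ≠ 4 := by omega
        have hi3 : i ≠ 3 := by omega
        obtain ⟨t', ht', e'⟩ := ihm (next i b (p.run s))
          (by simp [next, State.setReg, hbi', hb3, hb', hi']; omega)
          (by rw [hnext b hb]; simp [next, State.setReg, hi4, hi']; omega)
          (fun x hx => by rw [hnext x hx]; exact hN x hx)
        refine ⟨t + (1 + (1 + 1)) + t' + 1, by rw [Nat.succ_mul]; omega, ?_⟩
        refine .loop_step (by omega) (.seq e (.seq (.const _ _ _) (.seq (.add _ _ _ _)
          (.sub _ _ _ _)))) ?_
        rw [Function.iterate_succ_apply]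
        convert e' using 1
        simp [next, State.setReg, hi3]
    have hb4 : b ≠ 4 := by omega
    have hbi : b ≠ i := by omega
    have hi4 : i ≠ 4 := by omega
    obtain ⟨t, ht, e⟩ := key (s.reg b) ((s.setReg i 0).setReg 4 (s.reg b))
      (by simp [State.setReg]) (by simp [State.setReg, hb4, hbi, hi4])
      (fun x hx => by
        have h1 : x ≠ i := by omega
        have h2 : x ≠ 4 := by omega
        simpa [State.setReg, h1, h2] using hN x hx)
    refine ⟨1 + (1 + t), ?_, .seq (.const _ _ _) (.seq (.sub _ _ _ _) ?_)⟩
    · have := Nat.mul_le_mul_right (p.time.eval N + 4) (hN b hb)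
      simp only [time, Polynomial.eval_add, Polynomial.eval_mul, Polynomial.eval_X,
        Polynomial.eval_ofNat]
      omega
    · have h0 : ((s.setReg i 0).setReg 4 ((s.setReg i 0).reg b - (s.setReg i 0).reg i)) =
          (s.setReg i 0).setReg 4 (s.reg b) := by simp [State.setReg, hbi]
      rw [h0]
      exact e

/-- The invariant rule for counted loops. -/
theorem run_rep {i b : ℕ} {p : Prog} {s : State} (m : ℕ) (I : ℕ → State → Prop)
    (h : (rep i b p).wf = true) (hm : s.reg b = m)
    (hI : ∀ k σ x v, x = i ∨ x = 3 ∨ x = 4 → I k σ → I k (σ.setReg x v)) (h0 : I 0 s)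
    (hs : ∀ k < m, ∀ σ : State, σ.reg i = k →
      (∀ x, (rep i b p).writesReg x = false → σ.reg x = s.reg x) →
      (∀ a, (rep i b p).writesArr a = false → σ.arr a = s.arr a) → I k σ → I (k + 1) (p.run σ)) :
    I m ((rep i b p).run s) := by
  subst hm
  simp only [wf, Bool.and_eq_true, Bool.not_eq_true', decide_eq_true_eq] at h
  obtain ⟨⟨⟨hi, hb⟩, hpi⟩, hp⟩ := h
  have key : ∀ k ≤ s.reg b, ∀ σ,
      σ = (fun s => next i b (p.run s))^[k] ((s.setReg i 0).setReg 4 (s.reg b)) →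
      σ.reg i = k ∧ (∀ x, (rep i b p).writesReg x = false → σ.reg x = s.reg x) ∧
        (∀ a, (rep i b p).writesArr a = false → σ.arr a = s.arr a) ∧ I k σ := by
    intro k
    induction k with
    | zero =>
      rintro _ σ rfl
      refine ⟨?_, ?_, fun a _ => rfl, hI _ _ _ _ (by simp) (hI _ _ _ _ (by simp) h0)⟩
      · have hi4 : i ≠ 4 := by omega
        simp [State.setReg, hi4]
      · intro x hx
        simp only [writesReg, Bool.or_eq_false_iff, beq_eq_false_iff_ne] at hx
        simp [State.setReg, hx]
    | succ k ih =>
      rintro hk σ rfl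
      obtain ⟨h1, h2, h3, h4⟩ := ih (by omega) _ rfl
      rw [Function.iterate_succ_apply']
      set τ := (fun s => next i b (p.run s))^[k] ((s.setReg i 0).setReg 4 (s.reg b))
      refine ⟨?_, ?_, ?_, ?_⟩
      · have hi4 : i ≠ 4 := by omega
        simp [next, State.setReg, hi4, run_reg p τ hpi, h1]
      · intro x hx
        rw [← h2 x hx]
        simp only [writesReg, Bool.or_eq_false_iff, beq_eq_false_iff_ne] at hx
        simp [next, State.setReg, hx, run_reg]
      · intro a ha
        rw [← h3 a ha]
        exact run_arr p τ ha
      · exact hI _ _ _ _ (by simp) (hI _ _ _ _ (by simp) (hI _ _ _ _ (by simp)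
          (hs k (by omega) τ h1 h2 h3 h4)))
  exact (key _ le_rfl _ rfl).2.2.2

end Prog

end Ram

/-! ### Unit jobs in time windows -/

namespace Windows

variable {ι : Type*} [DecidableEq ι]

/-- The jobs of `P` whose window `[lo u, hi u)` lies in `[a, b)`. -/
def inside (lo hi : ι → ℕ) (P : Finset ι) (a b : ℕ) : Finset ι :=
  P.filter fun u => a ≤ lo u ∧ hi u ≤ b

/-- Hall's condition for windows only has to be checked on intervals. -/
theorem exists_injOn_of_card_inside_le {lo hi : ι → ℕ} {P : Finset ι} {d : ℕ}
    (hd : ∀ u ∈ P, hi u ≤ d) {Z : Finset ℕ}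
    (h : ∀ a b, a ≤ b → b ≤ d → (inside lo hi P a b).card ≤ (Z ∩ Finset.Ico a b).card) :
    ∃ f : ι → ℕ, (∀ u ∈ P, lo u ≤ f u ∧ f u < hi u ∧ f u ∈ Z) ∧ Set.InjOn f P := by
  -- Strong induction on `b`, splitting at the last slot `v < b` that no window of `Q` covers. A job
  -- with `lo u ≤ v` must have `hi u ≤ v`, so no job straddles `v`. To the right of `v` every slot
  -- of `Z` is available to `Q`, so there the interval hypothesis bounds the jobs by slots in the
  -- neighbourhood of `Q`.
  have core : ∀ Q ⊆ P, ∀ b ≤ d, (Q.filter fun u => hi u ≤ b).card ≤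
      ((Q.biUnion fun u => Z ∩ Finset.Ico (lo u) (hi u)) ∩ Finset.range b).card := by
    intro Q hQ b
    have sub : ∀ a b, a ≤ b → b ≤ d → (∀ v, a ≤ v → v < b → ∃ u ∈ Q, lo u ≤ v ∧ v < hi u) →
        (inside lo hi Q a b).card ≤
          ((Q.biUnion fun u => Z ∩ Finset.Ico (lo u) (hi u)) ∩ Finset.Ico a b).card := by
      intro a b hab hb hc
      calc _ ≤ (inside lo hi P a b).card := Finset.card_le_card (Finset.filter_subset_filter _ hQ)
        _ ≤ _ := h a b hab hb
        _ ≤ _ := Finset.card_le_card fun v hv => by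
          simp only [Finset.mem_inter, Finset.mem_Ico, Finset.mem_biUnion] at hv ⊢
          obtain ⟨u, hu, h1, h2⟩ := hc v hv.2.1 hv.2.2
          exact ⟨⟨u, hu, hv.1, h1, h2⟩, hv.2⟩
    induction b using Nat.strong_induction_on with
    | _ b ih =>
      intro hb
      by_cases hc : ∃ v < b, ¬ ∃ u ∈ Q, lo u ≤ v ∧ v < hi u
      · obtain ⟨v, ⟨hv, hvc⟩, hmax⟩ : ∃ v, (v < b ∧ ¬ ∃ u ∈ Q, lo u ≤ v ∧ v < hi u) ∧
            ∀ w, v + 1 ≤ w → w < b → ∃ u ∈ Q, lo u ≤ w ∧ w < hi u := by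
          classical
          obtain ⟨v, hv, hvm⟩ := Finset.exists_max_image
            ((Finset.range b).filter fun v => ¬ ∃ u ∈ Q, lo u ≤ v ∧ v < hi u) id
            (by obtain ⟨v, hv⟩ := hc; exact ⟨v, by simpa using hv⟩)
          refine ⟨v, by simpa using hv, fun w hw hwb => ?_⟩
          by_contra hcon
          have := hvm w (by simpa [hwb] using hcon)
          simp only [id] at this
          omega
        have h1 := ih v hv (by omega)
        have h2 := sub (v + 1) b hv hb hmax
        have h3 : (Q.filter fun u => hi u ≤ b) ⊆
            (Q.filter fun u => hi u ≤ v) ∪ inside lo hi Q (v + 1) b := by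
          intro u hu
          simp only [inside, Finset.mem_filter, Finset.mem_union] at hu ⊢
          by_cases hl : v + 1 ≤ lo u
          · exact .inr ⟨hu.1, hl, hu.2⟩
          · refine .inl ⟨hu.1, ?_⟩
            by_contra hcon
            exact hvc ⟨u, hu.1, by omega, by omega⟩
        have h4 := (Finset.card_le_card h3).trans (Finset.card_union_le _ _)
        set U := Q.biUnion fun u => Z ∩ Finset.Ico (lo u) (hi u)
        have h5 : (U ∩ Finset.range v).card + (U ∩ Finset.Ico (v + 1) b).card ≤
            (U ∩ Finset.range b).card := by
          rw [← Finset.card_union_of_disjoint]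
          · refine Finset.card_le_card fun w hw => ?_
            simp only [Finset.mem_union, Finset.mem_inter, Finset.mem_range,
              Finset.mem_Ico] at hw ⊢
            rcases hw with ⟨h, h'⟩ | ⟨h, h'⟩ <;> exact ⟨h, by omega⟩
          · rw [Finset.disjoint_left]
            intro w hw hw'
            simp only [Finset.mem_inter, Finset.mem_range, Finset.mem_Ico] at hw hw'
            omega
        omega
      · push Not at hc
        have := sub 0 b (Nat.zero_le _) hb fun v _ hv => hc v hv
        simpa [inside] using this
  -- Hall's marriage theorem; taking `b = d` in `core` counts all of `Q`.
  obtain ⟨g, hg, hgm⟩ := (Finset.all_card_le_biUnion_card_iff_exists_injective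
    (fun u : P => Z ∩ Finset.Ico (lo u) (hi u))).1 fun Q => by
      have := core (Q.map (Function.Embedding.subtype _)) (fun u hu => by
        obtain ⟨v, _, rfl⟩ := Finset.mem_map.1 hu
        exact v.2) d le_rfl
      rw [Finset.filter_true_of_mem, Finset.card_map] at this
      · refine this.trans (Finset.card_le_card fun v hv => ?_)
        simp only [Finset.mem_inter, Finset.mem_biUnion, Finset.mem_map] at hv ⊢
        obtain ⟨⟨_, ⟨u, hu, rfl⟩, h⟩, _⟩ := hv
        exact ⟨u, hu, h⟩
      · intro u hu
        obtain ⟨v, _, rfl⟩ := Finset.mem_map.1 hu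
        exact hd _ v.2
  refine ⟨fun u => if hu : u ∈ P then g ⟨u, hu⟩ else 0, fun u hu => ?_, fun u hu v hv huv => ?_⟩
  · have := hgm ⟨u, hu⟩
    simp only [Finset.mem_inter, Finset.mem_Ico] at this
    simp [hu, this]
  · rw [Finset.mem_coe] at hu hv
    simp only [hu, hv, dif_pos] at huv
    simpa using hg huv

/-! ### Schedules as solutions of difference constraints -/

/-- `f` places every job of `S ∪ T` in its window, without collisions inside `S` and inside `T`. -/
def IsSchedule (lo hi : ι → ℕ) (S T : Finset ι) (f : ι → ℕ) : Prop :=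
  (∀ u ∈ S ∪ T, lo u ≤ f u ∧ f u < hi u) ∧ Set.InjOn f S ∧ Set.InjOn f T

/-- The difference constraints for the pair `(a, b)` on the number `t v` of slots before `v` which
are not used by `S ∩ T`. -/
def Admits (lo hi : ι → ℕ) (S T : Finset ι) (t : ℕ → ℕ) (a b : ℕ) : Prop :=
  t a + max (inside lo hi (S \ T) a b).card (inside lo hi (T \ S) a b).card ≤ t b ∧
    t b + (inside lo hi (S ∩ T) a b).card ≤ t a + (b - a)

/-- `t` satisfies all difference constraints up to `d`. -/
def IsPotential (lo hi : ι → ℕ) (S T : Finset ι) (d : ℕ) (t : ℕ → ℕ) : Prop :=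
  ∀ a b, a ≤ b → b ≤ d → Admits lo hi S T t a b

/-- Count the slots not used by `S ∩ T`. Injectivity on `S` keeps the jobs of `S \ T` off the slots
of `S ∩ T`, and likewise for `T`, so jobs inside `[a, b)` occupy distinct slots of the appropriate
kind there. -/
theorem IsSchedule.exists_isPotential {lo hi : ι → ℕ} {S T : Finset ι} {f : ι → ℕ}
    (hf : IsSchedule lo hi S T f) (d : ℕ) : ∃ t, IsPotential lo hi S T d t := by
  obtain ⟨hw, hS, hT⟩ := hf
  set Z : Finset ℕ := (S ∩ T).image f with hZ
  refine ⟨fun a => (Finset.range a \ Z).card, fun a b hab _ => ?_⟩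
  have hsplit : (Finset.range b \ Z).card =
      (Finset.range a \ Z).card + (Finset.Ico a b \ Z).card := by
    rw [← Finset.card_union_of_disjoint]
    · congr 1
      ext v
      simp only [Finset.mem_union, Finset.mem_sdiff, Finset.mem_range, Finset.mem_Ico]
      by_cases v ∈ Z <;> simp_all
      omega
    · rw [Finset.disjoint_left]
      intro w hw hw'
      simp only [Finset.mem_sdiff, Finset.mem_range, Finset.mem_Ico] at hw hw'
      omega
  have hcompl : (Finset.Ico a b \ Z).card + (Finset.Ico a b ∩ Z).card = b - a := by
    rw [Finset.card_sdiff_add_card_inter, Nat.card_Ico]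
  have hside : ∀ P Q : Finset ι, P ⊆ S ∪ T → Set.InjOn f P → S ∩ T ⊆ P → Q ⊆ P →
      Disjoint Q (S ∩ T) → (inside lo hi Q a b).card ≤ (Finset.Ico a b \ Z).card := by
    intro P Q hPA hP hST hQ hdis
    refine Finset.card_le_card_of_injOn f (fun u hu => ?_) (hP.mono fun u hu => ?_)
    · simp only [inside, Finset.coe_filter, Set.mem_ofPred_eq] at hu
      have := hw u (hPA (hQ hu.1))
      simp only [Finset.coe_sdiff, Finset.coe_Ico, Set.mem_sdiff, Set.mem_Ico, Finset.mem_coe]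
      refine ⟨by omega, fun hv => ?_⟩
      obtain ⟨w, hwm, hwu⟩ := Finset.mem_image.1 hv
      have := hP (hST hwm) (hQ hu.1) hwu
      subst this
      exact Finset.disjoint_left.1 hdis hu.1 hwm
    · exact hQ (Finset.mem_filter.1 hu).1
  have h1 := hside S (S \ T) Finset.subset_union_left hS Finset.inter_subset_left
    Finset.sdiff_subset (by
      rw [Finset.disjoint_left]; intro u; simp only [Finset.mem_sdiff, Finset.mem_inter]; tauto)
  have h2 := hside T (T \ S) Finset.subset_union_right hT Finset.inter_subset_right
    Finset.sdiff_subset (by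
      rw [Finset.disjoint_left]; intro u; simp only [Finset.mem_sdiff, Finset.mem_inter]; tauto)
  have h3 : (inside lo hi (S ∩ T) a b).card ≤ (Finset.Ico a b ∩ Z).card := by
    refine Finset.card_le_card_of_injOn f (fun u hu => ?_) (hS.mono fun u hu => ?_)
    · simp only [inside, Finset.coe_filter, Set.mem_ofPred_eq] at hu
      have := hw u (Finset.mem_union_left _ (Finset.mem_inter.1 hu.1).1)
      simp only [Finset.coe_inter, Finset.coe_Ico, Set.mem_inter_iff, Set.mem_Ico, Finset.mem_coe]
      exact ⟨by omega, Finset.mem_image_of_mem f hu.1⟩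
    · exact (Finset.mem_inter.1 (Finset.mem_filter.1 hu).1).1
  refine ⟨?_, ?_⟩
  · change (Finset.range a \ Z).card + _ ≤ (Finset.range b \ Z).card
    have := max_le h1 h2
    omega
  · change (Finset.range b \ Z).card + _ ≤ (Finset.range a \ Z).card + (b - a)
    omega

theorem IsPotential.exists_isSchedule {lo hi : ι → ℕ} {S T : Finset ι} {d : ℕ} {t : ℕ → ℕ}
    (hd : ∀ u ∈ S ∪ T, hi u ≤ d) (ht : IsPotential lo hi S T d t) :
    ∃ f, IsSchedule lo hi S T f := by
  -- The slots where `t` jumps. The constraints for `(b, b + 1)` allow only jumps of 0 or 1, so `t`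
  -- counts `Z` up to an additive constant.
  set Z : Finset ℕ := (Finset.range d).filter fun v => t (v + 1) = t v + 1 with hZ
  have hcard : ∀ a b, a ≤ b → b ≤ d → t b = t a + (Z ∩ Finset.Ico a b).card := by
    intro a b hab
    induction b, hab using Nat.le_induction with
    | base => simp
    | succ b hab ih =>
      intro hb
      rw [← Finset.insert_Ico_right_eq_Ico_add_one hab]
      have h1 := (ht b (b + 1) (by omega) hb).1
      have h2 := (ht b (b + 1) (by omega) hb).2
      by_cases hbz : b ∈ Z
      · rw [Finset.inter_insert_of_mem hbz, Finset.card_insert_of_notMem (by simp)]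
        have := (Finset.mem_filter.1 hbz).2
        have := ih (by omega)
        omega
      · rw [Finset.inter_insert_of_notMem hbz]
        have h3 : t (b + 1) ≠ t b + 1 := fun h =>
          hbz (Finset.mem_filter.2 ⟨Finset.mem_range.2 hb, h⟩)
        have := ih (by omega)
        omega
  obtain ⟨fX, hX, hXi⟩ := exists_injOn_of_card_inside_le (lo := lo) (hi := hi) (P := S \ T)
    (Z := Z) (fun u hu => hd u (Finset.mem_union_left _ (Finset.mem_sdiff.1 hu).1))
    fun a b hab hb => by
      have h1 := (ht a b hab hb).1
      have := hcard a b hab hb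
      have := le_max_left (inside lo hi (S \ T) a b).card (inside lo hi (T \ S) a b).card
      omega
  obtain ⟨fY, hY, hYi⟩ := exists_injOn_of_card_inside_le (lo := lo) (hi := hi) (P := T \ S)
    (Z := Z) (fun u hu => hd u (Finset.mem_union_right _ (Finset.mem_sdiff.1 hu).1))
    fun a b hab hb => by
      have h1 := (ht a b hab hb).1
      have := hcard a b hab hb
      have := le_max_right (inside lo hi (S \ T) a b).card (inside lo hi (T \ S) a b).card
      omega
  obtain ⟨fC, hC, hCi⟩ := exists_injOn_of_card_inside_le (lo := lo) (hi := hi) (P := S ∩ T)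
    (Z := Finset.range d \ Z)
    (fun u hu => hd u (Finset.mem_union_left _ (Finset.mem_inter.1 hu).1))
    fun a b hab hb => by
      have h1 := (ht a b hab hb).2
      have := hcard a b hab hb
      have h3 : (Finset.Ico a b \ Z).card + (Finset.Ico a b ∩ Z).card = b - a := by
        rw [Finset.card_sdiff_add_card_inter, Nat.card_Ico]
      have h4 : Finset.Ico a b \ Z ⊆ (Finset.range d \ Z) ∩ Finset.Ico a b := by
        intro v hv
        simp only [Finset.mem_sdiff, Finset.mem_inter, Finset.mem_range, Finset.mem_Ico] at hv ⊢
        exact ⟨⟨by omega, hv.2⟩, hv.1⟩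
      have h5 := Finset.card_le_card h4
      rw [Finset.inter_comm] at h3
      omega
  -- `fC` avoids `Z` while `fX` and `fY` stay in it. The only possible collisions are between `fX`
  -- and `fY`, and these are allowed.
  refine ⟨fun u => if u ∈ S then if u ∈ T then fC u else fX u else fY u, ?_, ?_, ?_⟩
  · intro u hu
    by_cases hS : u ∈ S
    · by_cases hT : u ∈ T
      · have := hC u (by simp [hS, hT])
        simp [hS, hT, this]
      · have := hX u (by simp [hS, hT])
        simp [hS, hT, this]
    · have hT : u ∈ T := by simpa [hS] using hu
      have := hY u (by simp [hS, hT])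
      simp [hS, this]
  · intro u hu v hv huv
    rw [Finset.mem_coe] at hu hv
    by_cases hu' : u ∈ T <;> by_cases hv' : v ∈ T <;> simp only [hu, hv, hu', hv', if_true,
      if_false] at huv
    · exact hCi (by simp [hu, hu']) (by simp [hv, hv']) huv
    · have h1 := (hC u (by simp [hu, hu'])).2.2
      have h2 := (hX v (by simp [hv, hv'])).2.2
      rw [huv] at h1
      exact absurd h2 (Finset.mem_sdiff.1 h1).2
    · have h1 := (hX u (by simp [hu, hu'])).2.2
      have h2 := (hC v (by simp [hv, hv'])).2.2
      rw [← huv] at h2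
      exact absurd h1 (Finset.mem_sdiff.1 h2).2
    · exact hXi (by simp [hu, hu']) (by simp [hv, hv']) huv
  · intro u hu v hv huv
    rw [Finset.mem_coe] at hu hv
    by_cases hu' : u ∈ S <;> by_cases hv' : v ∈ S <;> simp only [hu, hv, hu', hv', if_true,
      if_false] at huv
    · exact hCi (by simp [hu, hu']) (by simp [hv, hv']) huv
    · have h1 := (hC u (by simp [hu, hu'])).2.2
      have h2 := (hY v (by simp [hv, hv'])).2.2
      rw [huv] at h1
      exact absurd h2 (Finset.mem_sdiff.1 h1).2
    · have h1 := (hY u (by simp [hu, hu'])).2.2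
      have h2 := (hC v (by simp [hv, hv'])).2.2
      rw [← huv] at h2
      exact absurd h1 (Finset.mem_sdiff.1 h2).2
    · exact hYi (by simp [hu, hu']) (by simp [hv, hv']) huv

/-- Some potential takes values at most `d` only. -/
theorem IsPotential.exists_le {lo hi : ι → ℕ} {S T : Finset ι} {d : ℕ} {t : ℕ → ℕ}
    (ht : IsPotential lo hi S T d t) :
    ∃ t', IsPotential lo hi S T d t' ∧ ∀ v ≤ d, t' v ≤ d := by
  -- The constraints are invariant under shifts. Since `t 0 ≤ t v` the truncated difference is
  -- exact, and the second constraint for `(0, v)` bounds it by `v`.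
  refine ⟨fun v => t v - t 0, fun a b hab hb => ?_, fun v hv => ?_⟩
  · have h1 := ht a b hab hb
    have h2 := (ht 0 a (by omega) (by omega)).1
    have h3 := (ht 0 b (by omega) (by omega)).1
    unfold Admits at h1 ⊢
    simp only
    omega
  · have h1 := (ht 0 v (by omega) (by omega)).2
    simp only
    omega

end Windows

/-! ### Relaxation of the difference constraints -/

namespace Windows

/-- The indices below `n` at which `g` does not vanish. -/
def supp (n : ℕ) (g : ℕ → ℕ) : Finset ℕ := (Finset.range n).filter fun u => g u ≠ 0

theorem card_inside_sdiff (lo hi g h : ℕ → ℕ) (n a b : ℕ) :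
    (inside lo hi (supp n g \ supp n h) a b).card =
      ∑ u ∈ Finset.range n, if g u ≠ 0 ∧ h u = 0 ∧ a ≤ lo u ∧ hi u ≤ b then 1 else 0 := by
  rw [← Finset.card_filter]
  congr 1
  ext u
  simp only [inside, supp, Finset.mem_filter, Finset.mem_sdiff, Finset.mem_range]
  tauto

theorem card_inside_inter (lo hi g h : ℕ → ℕ) (n a b : ℕ) :
    (inside lo hi (supp n g ∩ supp n h) a b).card =
      ∑ u ∈ Finset.range n, if g u ≠ 0 ∧ h u ≠ 0 ∧ a ≤ lo u ∧ hi u ≤ b then 1 else 0 := by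
  rw [← Finset.card_filter]
  congr 1
  ext u
  simp only [inside, supp, Finset.mem_filter, Finset.mem_inter, Finset.mem_range]
  tauto

theorem sum_update_add (t : ℕ → ℕ) {d b : ℕ} (hb : b ≤ d) (v : ℕ) :
    ∑ i ∈ Finset.range (d + 1), Function.update t b (t b + v) i =
      ∑ i ∈ Finset.range (d + 1), t i + v := by
  have hb' : b ∈ Finset.range (d + 1) := Finset.mem_range.2 (by omega)
  have := Finset.sum_update_of_mem hb' t (t b)
  rw [Function.update_eq_self] at this
  rw [Finset.sum_update_of_mem hb', this]
  omega

/-- Raise `t b`, then `t a`, by what the constraints for `(a, b)` lack. The second component is the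
total change. -/
def relax (t : ℕ → ℕ) (a b m c : ℕ) : (ℕ → ℕ) × ℕ :=
  let v := t a + m - t b
  let t' := Function.update t b (t b + v)
  let w := t' b + c + a - b - t' a
  (Function.update t' a (t' a + w), v + w)

variable {lo hi : ℕ → ℕ} {S T : Finset ℕ} {d : ℕ} {t : ℕ → ℕ} {a b : ℕ}

/-- A raised value is a lower bound that the constraints impose on `t'` as well, because it is
computed from values already below those of `t'`. -/
theorem relax_le {t' : ℕ → ℕ} (ht' : Admits lo hi S T t' a b)
    (h : ∀ v ≤ d, t v ≤ t' v) (hab : a ≤ b) (hb : b ≤ d) :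
    ∀ v ≤ d, (relax t a b (max (inside lo hi (S \ T) a b).card (inside lo hi (T \ S) a b).card)
      (inside lo hi (S ∩ T) a b).card).1 v ≤ t' v := by
  intro v hv
  have h1 := h a (by omega)
  have h2 := h b hb
  have h3 := h v hv
  obtain ⟨h4, h5⟩ := ht'
  simp only [relax, Function.update_apply]
  split_ifs <;> subst_vars <;> omega

theorem sum_relax (m c : ℕ) (hab : a ≤ b) (hb : b ≤ d) :
    ∑ i ∈ Finset.range (d + 1), (relax t a b m c).1 i =
      ∑ i ∈ Finset.range (d + 1), t i + (relax t a b m c).2 := by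
  simp only [relax]
  rw [sum_update_add _ (hab.trans hb), sum_update_add _ hb]
  omega

theorem relax_eq_self {m c : ℕ} (h : (relax t a b m c).2 = 0) : (relax t a b m c).1 = t := by
  simp only [relax, Nat.add_eq_zero_iff] at h ⊢
  rw [h.2, h.1]
  simp

/-- The two increments are truncated differences; their vanishing is exactly the two inequalities.
-/
theorem admits_of_relax
    (h : (relax t a b (max (inside lo hi (S \ T) a b).card (inside lo hi (T \ S) a b).card)
      (inside lo hi (S ∩ T) a b).card).2 = 0) (hab : a ≤ b) : Admits lo hi S T t a b := by
  simp only [relax, Nat.add_eq_zero_iff] at h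
  obtain ⟨h1, h2⟩ := h
  rw [h1] at h2
  simp at h2
  unfold Admits
  omega

end Windows

/-! ### The program -/

namespace Ram

namespace Prog

open Windows

/-- Add job `reg 11` to the counters `12`, `13`, `14` for `S \ T`, `T \ S`, `S ∩ T` if its window
lies in `[reg 9, reg 10)`. -/
def countBody : Prog :=
  load 15 4 11 ;; sub 15 9 15 ;; load 16 5 11 ;; sub 16 16 10 ;; add 15 15 16 ;;
    cond 15 skip (const 18 1 ;; load 15 0 11 ;; load 16 1 11 ;;
      cond 15 (cond 16 (add 14 14 18) (add 12 12 18)) (add 13 13 18))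

/-- Count the jobs inside `[reg 9, reg 10)`. -/
def count : Prog :=
  const 12 0 ;; const 13 0 ;; const 14 0 ;; rep 11 0 countBody

/-- Relax the constraints for `(reg 9, reg 10)` in array `6`, given the counters. -/
def relaxCounted : Prog :=
  sub 15 12 13 ;; add 13 13 15 ;; load 15 6 9 ;; load 16 6 10 ;; add 13 15 13 ;; sub 13 13 16 ;;
    add 16 16 13 ;; store 6 10 16 ;; add 17 17 13 ;;
    load 15 6 9 ;; load 16 6 10 ;; add 14 16 14 ;; add 14 14 9 ;; sub 14 14 10 ;; sub 14 14 15 ;;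
    add 15 15 14 ;; store 6 9 15 ;; add 17 17 14

/-- Relax the constraints for `(reg 9, reg 10)` if `reg 9 ≤ reg 10`. -/
def relaxPair : Prog :=
  sub 15 9 10 ;; cond 15 skip (count ;; relaxCounted)

/-- Relax all constraints once; register `17` receives the total change. -/
def round : Prog :=
  const 17 0 ;; rep 9 2 (rep 10 2 relaxPair)

/-- Register `17` receives `0` if there is a schedule for the windows in arrays `4`, `5`. -/
def test : Prog :=
  const 15 0 ;; rep 9 2 (store 6 9 15) ;; const 17 0 ;; rep 7 2 (rep 8 2 round)

/-! ### Correctness of the feasibility test -/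

theorem count_run (s : State)
    (hA : ∀ u < s.reg 0, s.arr 0 u ≠ 0 ∨ s.arr 1 u ≠ 0) (S T : Finset ℕ)
    (hS : S = supp (s.reg 0) (s.arr 0)) (hT : T = supp (s.reg 0) (s.arr 1)) :
    (count.run s).reg 12 = (inside (s.arr 4) (s.arr 5) (S \ T) (s.reg 9) (s.reg 10)).card ∧
    (count.run s).reg 13 = (inside (s.arr 4) (s.arr 5) (T \ S) (s.reg 9) (s.reg 10)).card ∧
    (count.run s).reg 14 = (inside (s.arr 4) (s.arr 5) (S ∩ T) (s.reg 9) (s.reg 10)).card := by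
  subst hS hT
  simp only [card_inside_sdiff, card_inside_inter, count, run]
  refine run_rep (s.reg 0) (fun k σ =>
    σ.reg 12 = ∑ u ∈ Finset.range k, (if s.arr 0 u ≠ 0 ∧ s.arr 1 u = 0 ∧
      s.reg 9 ≤ s.arr 4 u ∧ s.arr 5 u ≤ s.reg 10 then 1 else 0) ∧
    σ.reg 13 = ∑ u ∈ Finset.range k, (if s.arr 1 u ≠ 0 ∧ s.arr 0 u = 0 ∧
      s.reg 9 ≤ s.arr 4 u ∧ s.arr 5 u ≤ s.reg 10 then 1 else 0) ∧
    σ.reg 14 = ∑ u ∈ Finset.range k, (if s.arr 0 u ≠ 0 ∧ s.arr 1 u ≠ 0 ∧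
      s.reg 9 ≤ s.arr 4 u ∧ s.arr 5 u ≤ s.reg 10 then 1 else 0)) rfl rfl ?_ ?_ ?_
  · rintro k σ x v (rfl | rfl | rfl) h <;> simpa [State.setReg] using h
  · simp [State.setReg]
  · intro k hk σ h11 hr ha ⟨h12, h13, h14⟩
    have r9 : σ.reg 9 = s.reg 9 := hr 9 rfl
    have r10 : σ.reg 10 = s.reg 10 := hr 10 rfl
    have a0 : σ.arr 0 = s.arr 0 := ha 0 rfl
    have a1 : σ.arr 1 = s.arr 1 := ha 1 rfl
    have a4 : σ.arr 4 = s.arr 4 := ha 4 rfl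
    have a5 : σ.arr 5 = s.arr 5 := ha 5 rfl
    simp only [Finset.sum_range_succ, ← h12, ← h13, ← h14]
    have hk' := hA k hk
    by_cases hin : s.reg 9 ≤ s.arr 4 k ∧ s.arr 5 k ≤ s.reg 10
    · have e1 : s.reg 9 - s.arr 4 k + (s.arr 5 k - s.reg 10) = 0 := by omega
      by_cases h0 : s.arr 0 k = 0 <;> by_cases h1 : s.arr 1 k = 0 <;>
        simp_all [countBody, run, State.setReg, Function.update_apply]
    · have e2 : ∀ p q : Prop, (p ∧ q ∧ s.reg 9 ≤ s.arr 4 k ∧ s.arr 5 k ≤ s.reg 10) ↔ False := by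
        tauto
      simp only [e2, if_false]
      by_cases h9 : s.reg 9 - s.arr 4 k = 0
      · have e1 : s.arr 5 k - s.reg 10 ≠ 0 := by omega
        simp [countBody, run, State.setReg, r9, r10, a4, a5, h11, h9, e1]
      · simp [countBody, run, State.setReg, r9, r10, a4, a5, h11, h9]

theorem relaxCounted_run (s : State) :
    (relaxCounted.run s).arr 6 =
      (Windows.relax (s.arr 6) (s.reg 9) (s.reg 10) (max (s.reg 12) (s.reg 13)) (s.reg 14)).1 ∧
    (relaxCounted.run s).reg 17 = s.reg 17 +
      (Windows.relax (s.arr 6) (s.reg 9) (s.reg 10) (max (s.reg 12) (s.reg 13)) (s.reg 14)).2 := by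
  -- The maximum, obtained from addition and truncated subtraction alone.
  have hm : s.reg 13 + (s.reg 12 - s.reg 13) = max (s.reg 12) (s.reg 13) := by omega
  constructor
  · simp [relaxCounted, run, State.setReg, State.setArr, Windows.relax, hm]
  · simp [relaxCounted, run, State.setReg, State.setArr, Windows.relax, hm, add_assoc]

/-- The memory holds an instance: `n`, `d`, `d + 1` in the registers, sets `S`, `T` that cover
`range n` in arrays `0`, `1`. -/
structure Instance (s : State) (n d : ℕ) (S T : Finset ℕ) (lo hi : ℕ → ℕ) : Prop where
  reg0 : s.reg 0 = n
  reg1 : s.reg 1 = d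
  reg2 : s.reg 2 = d + 1
  eqS : S = supp n (s.arr 0)
  eqT : T = supp n (s.arr 1)
  cover : ∀ u < n, s.arr 0 u ≠ 0 ∨ s.arr 1 u ≠ 0
  arr4 : s.arr 4 = lo
  arr5 : s.arr 5 = hi

variable {s σ : State} {n d : ℕ} {S T : Finset ℕ} {lo hi : ℕ → ℕ}

theorem Instance.congr (h : Instance s n d S T lo hi) {lo' hi' : ℕ → ℕ} (hr : ∀ x < 3, σ.reg x = s.reg x)
    (h0 : σ.arr 0 = s.arr 0) (h1 : σ.arr 1 = s.arr 1) (h4 : σ.arr 4 = lo') (h5 : σ.arr 5 = hi') :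
    Instance σ n d S T lo' hi' where
  reg0 := by rw [hr 0 (by omega), h.reg0]
  reg1 := by rw [hr 1 (by omega), h.reg1]
  reg2 := by rw [hr 2 (by omega), h.reg2]
  eqS := by rw [h0, h.eqS]
  eqT := by rw [h1, h.eqT]
  cover := by rw [h0, h1]; exact h.cover
  arr4 := h4
  arr5 := h5

theorem Instance.frame (h : Instance s n d S T lo hi) {p : Prog}
    (hr : ∀ x, p.writesReg x = false → σ.reg x = s.reg x)
    (ha : ∀ a, p.writesArr a = false → σ.arr a = s.arr a) (hp : p.wf = true)
    (h0 : p.writesArr 0 = false) (h1 : p.writesArr 1 = false) (h4 : p.writesArr 4 = false)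
    (h5 : p.writesArr 5 = false) : Instance σ n d S T lo hi :=
  h.congr (fun x hx => hr x (writesReg_of_wf hp hx)) (ha 0 h0) (ha 1 h1)
    ((ha 4 h4).trans h.arr4) ((ha 5 h5).trans h.arr5)

theorem Instance.run (h : Instance s n d S T lo hi) {p : Prog} (hp : p.wf = true)
    (h0 : p.writesArr 0 = false) (h1 : p.writesArr 1 = false) (h4 : p.writesArr 4 = false)
    (h5 : p.writesArr 5 = false) : Instance (p.run s) n d S T lo hi :=
  h.frame (fun _ => run_reg p s) (fun _ => run_arr p s) hp h0 h1 h4 h5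

theorem relaxPair_run (h : Instance s n d S T lo hi) {a b : ℕ} (ha : s.reg 9 = a)
    (hb : s.reg 10 = b) (hab : a ≤ b) :
    let r := Windows.relax (s.arr 6) a b
      (max (inside lo hi (S \ T) a b).card (inside lo hi (T \ S) a b).card)
      (inside lo hi (S ∩ T) a b).card
    (relaxPair.run s).arr 6 = r.1 ∧ (relaxPair.run s).reg 17 = s.reg 17 + r.2 := by
  have hs : relaxPair.run s = relaxCounted.run (count.run (s.setReg 15 0)) := by
    have : s.reg 9 - s.reg 10 = 0 := by omega
    simp [relaxPair, Prog.run, this, State.setReg]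
  set σ := s.setReg 15 0 with hσ
  obtain ⟨h1, h2, h3⟩ := count_run σ (h.reg0 ▸ h.cover) S T (h.reg0 ▸ h.eqS) (h.reg0 ▸ h.eqT)
  have r9 : (count.run σ).reg 9 = a := by rw [run_reg count σ rfl]; exact ha
  have r10 : (count.run σ).reg 10 = b := by rw [run_reg count σ rfl]; exact hb
  have r17 : (count.run σ).reg 17 = s.reg 17 := run_reg count σ rfl
  have a6 : (count.run σ).arr 6 = s.arr 6 := run_arr count σ rfl
  have e4 : σ.arr 4 = lo := h.arr4
  have e5 : σ.arr 5 = hi := h.arr5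
  have e9 : σ.reg 9 = a := ha
  have e10 : σ.reg 10 = b := hb
  have := relaxCounted_run (count.run σ)
  rw [h1, h2, h3, r9, r10, r17, a6, e4, e5, e9, e10] at this
  rw [hs]
  exact this

theorem relaxPair_run_of_lt (h : s.reg 10 < s.reg 9) :
    (relaxPair.run s).arr 6 = s.arr 6 ∧ (relaxPair.run s).reg 17 = s.reg 17 := by
  have : s.reg 9 - s.reg 10 ≠ 0 := by omega
  simp [relaxPair, Prog.run, this, State.setReg]

/-- What is known after relaxing the constraints of the pairs in `D`, starting from `t`. -/
structure RoundInv (s : State) (t : ℕ → ℕ) (d : ℕ) (S T : Finset ℕ) (lo hi : ℕ → ℕ)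
    (D : ℕ → ℕ → Prop) : Prop where
  le : ∀ t', IsPotential lo hi S T d t' → (∀ v ≤ d, t v ≤ t' v) → ∀ v ≤ d, s.arr 6 v ≤ t' v
  sum : ∑ i ∈ Finset.range (d + 1), s.arr 6 i = ∑ i ∈ Finset.range (d + 1), t i + s.reg 17
  admits : s.reg 17 = 0 → ∀ a b, D a b → a ≤ b → b ≤ d → Admits lo hi S T (s.arr 6) a b

theorem RoundInv.congr {t : ℕ → ℕ} {D D' : ℕ → ℕ → Prop} (h : RoundInv s t d S T lo hi D)
    (h6 : σ.arr 6 = s.arr 6) (h17 : σ.reg 17 = s.reg 17)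
    (hD : ∀ a b, D' a b → a ≤ b → b ≤ d → D a b) : RoundInv σ t d S T lo hi D' where
  le := by rw [h6]; exact h.le
  sum := by rw [h6, h17]; exact h.sum
  admits := by
    rw [h6, h17]
    exact fun h0 a b hab h1 h2 => h.admits h0 a b (hD a b hab h1 h2) h1 h2

/-- Changes only accumulate in register 17. If it is still zero, the array has not moved, so
constraints checked earlier in the round still hold. -/
theorem RoundInv.relaxPair {t : ℕ → ℕ} {D : ℕ → ℕ → Prop} (h : RoundInv s t d S T lo hi D)
    (hs : Instance s n d S T lo hi) (hb : s.reg 10 ≤ d) :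
    RoundInv (relaxPair.run s) t d S T lo hi
      fun a b => D a b ∨ (a = s.reg 9 ∧ b = s.reg 10) := by
  rcases lt_or_ge (s.reg 10) (s.reg 9) with hlt | hab
  · obtain ⟨h6, h17⟩ := relaxPair_run_of_lt hlt
    refine h.congr h6 h17 fun a b hD h1 _ => hD.resolve_right ?_
    omega
  · obtain ⟨h6, h17⟩ := relaxPair_run hs rfl rfl hab
    refine ⟨fun t' ht' htt => ?_, ?_, ?_⟩
    · rw [h6]
      exact relax_le (ht' _ _ hab hb) (h.le t' ht' htt) hab hb
    · rw [h6, h17, sum_relax _ _ hab hb, h.sum, add_assoc]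
    · intro h0 a b hD h1 h2
      rw [h17, Nat.add_eq_zero_iff] at h0
      rw [h6, relax_eq_self h0.2]
      rcases hD with hD | ⟨rfl, rfl⟩
      · exact h.admits h0.1 a b hD h1 h2
      · exact admits_of_relax h0.2 hab

theorem round_run (hs : Instance s n d S T lo hi) :
    RoundInv (round.run s) (s.arr 6) d S T lo hi fun _ _ => True := by
  have hs' : Instance (s.setReg 17 0) n d S T lo hi := hs.run (p := const 17 0) rfl rfl rfl rfl rfl
  have := run_rep (i := 9) (b := 2) (p := rep 10 2 relaxPair) (s := s.setReg 17 0) (d + 1)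
    (fun k σ => RoundInv σ (s.arr 6) d S T lo hi fun a _ => a < k) rfl hs'.reg2
    (by rintro k σ x v (rfl | rfl | rfl) h <;> exact h.congr rfl (by simp [State.setReg]) fun _ _ h _ _ => h)
    ⟨fun _ _ h => h, by simp [State.setReg], by simp⟩ ?_
  · exact this.congr rfl rfl fun a b _ _ _ => by omega
  · intro k hk σ h9 hr ha hI
    have hσ : Instance σ n d S T lo hi := hs'.frame hr ha rfl rfl rfl rfl rfl
    have := run_rep (i := 10) (b := 2) (p := relaxPair) (s := σ) (d + 1)
      (fun j τ => RoundInv τ (s.arr 6) d S T lo hi fun a b => a < k ∨ (a = k ∧ b < j)) rfl hσ.reg2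
      (by rintro j τ x v (rfl | rfl | rfl) h <;>
            exact h.congr rfl (by simp [State.setReg]) fun _ _ h _ _ => h)
      (hI.congr rfl rfl fun a b h _ _ => by omega) ?_
    · exact this.congr rfl rfl fun a b _ _ _ => by omega
    · intro j hj τ h10 hr' ha' hJ
      have hτ : Instance τ n d S T lo hi := hσ.frame hr' ha' rfl rfl rfl rfl rfl
      have h9' : τ.reg 9 = k := (hr' 9 rfl).trans h9
      refine (hJ.relaxPair hτ (by omega)).congr rfl rfl fun a b hD _ _ => ?_
      omega

/-- What is known after `k` rounds. -/
structure TestInv (s : State) (d : ℕ) (S T : Finset ℕ) (lo hi : ℕ → ℕ) (k : ℕ) : Prop where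
  le : ∀ t, IsPotential lo hi S T d t → ∀ v ≤ d, s.arr 6 v ≤ t v
  pot : s.reg 17 = 0 → k = 0 ∨ IsPotential lo hi S T d (s.arr 6)
  sum : k ≤ ∑ i ∈ Finset.range (d + 1), s.arr 6 i ∨
    (s.reg 17 = 0 ∧ IsPotential lo hi S T d (s.arr 6))

theorem TestInv.congr {k : ℕ} (h : TestInv s d S T lo hi k) (h6 : σ.arr 6 = s.arr 6)
    (h17 : σ.reg 17 = s.reg 17) : TestInv σ d S T lo hi k where
  le := by rw [h6]; exact h.le
  pot := by rw [h6, h17]; exact h.pot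
  sum := by rw [h6, h17]; exact h.sum

theorem TestInv.round {k : ℕ} (h : TestInv s d S T lo hi k) (hs : Instance s n d S T lo hi) :
    TestInv (round.run s) d S T lo hi (k + 1) := by
  have hr := round_run hs
  have hpot : (Prog.round.run s).reg 17 = 0 → IsPotential lo hi S T d ((Prog.round.run s).arr 6) :=
    fun h0 a b hab hb => hr.admits h0 a b trivial hab hb
  refine ⟨fun t ht => hr.le t ht (h.le t ht), fun h0 => .inr (hpot h0), ?_⟩
  by_cases h0 : (Prog.round.run s).reg 17 = 0
  · exact .inr ⟨h0, hpot h0⟩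
  · have hsum := hr.sum
    rcases h.sum with h1 | ⟨_, h1⟩
    · exact .inl (by omega)
    · have := Finset.sum_le_sum fun i (hi : i ∈ Finset.range (d + 1)) =>
        hr.le _ h1 (fun _ _ => le_rfl) i (by simpa [Nat.lt_succ_iff] using hi)
      omega

theorem test_run (hs : Instance s n d S T lo hi) (hhi : ∀ u < n, hi u ≤ d) :
    (test.run s).reg 17 = 0 ↔ ∃ f, IsSchedule lo hi S T f := by
  have hs1 : Instance (s.setReg 15 0) n d S T lo hi := hs.run (p := const 15 0) rfl rfl rfl rfl rfl
  set s2 := (rep 9 2 (store 6 9 15)).run (s.setReg 15 0) with hs2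
  have hs2i : Instance s2 n d S T lo hi := hs1.run rfl rfl rfl rfl rfl
  have zero : ∀ v < d + 1, s2.arr 6 v = 0 := by
    refine run_rep (d + 1) (fun k σ => ∀ v < k, σ.arr 6 v = 0) rfl hs1.reg2
      (by rintro k σ x v - h; exact h) (by simp) ?_
    intro k hk σ h9 hr ha hI v hv
    have : σ.reg 15 = 0 := by rw [hr 15 rfl]; simp [State.setReg]
    by_cases hvk : v = k
    · simp [Prog.run, State.setArr, h9, this, hvk]
    · simp [Prog.run, State.setArr, h9, hvk, hI v (by omega)]
  have hs3 : Instance (s2.setReg 17 0) n d S T lo hi :=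
    hs2i.run (p := const 17 0) rfl rfl rfl rfl rfl
  have main : TestInv (test.run s) d S T lo hi ((d + 1) * (d + 1)) := by
    refine run_rep (d + 1) (fun k σ => TestInv σ d S T lo hi (k * (d + 1))) rfl hs3.reg2 ?_ ?_ ?_
    · rintro k σ x v (rfl | rfl | rfl) h <;> exact h.congr rfl (by simp [State.setReg])
    · refine ⟨fun t _ v hv => ?_, fun _ => .inl (by simp), .inl (by simp)⟩
      exact (zero v (by omega)).trans_le (Nat.zero_le _)
    · intro k hk σ h7 hr ha hI
      have hσ : Instance σ n d S T lo hi := hs3.frame hr ha rfl rfl rfl rfl rfl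
      rw [Nat.succ_mul]
      refine run_rep (d + 1) (fun j τ => TestInv τ d S T lo hi (k * (d + 1) + j)) rfl hσ.reg2
        ?_ hI ?_
      · rintro j τ x v (rfl | rfl | rfl) h <;> exact h.congr rfl (by simp [State.setReg])
      · intro j hj τ h8 hr' ha' hJ
        exact hJ.round (hσ.frame hr' ha' rfl rfl rfl rfl rfl)
  constructor
  · intro h0
    refine IsPotential.exists_isSchedule ?_ ((main.pot h0).resolve_left (by positivity))
    intro u hu
    rw [hs.eqS, hs.eqT] at hu
    simp only [supp, Finset.mem_union, Finset.mem_filter, Finset.mem_range] at hu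
    exact hhi u (by tauto)
  · rintro ⟨f, hf⟩
    obtain ⟨t, ht⟩ := hf.exists_isPotential d
    obtain ⟨t', ht', hle⟩ := ht.exists_le
    -- Below a potential with values at most `d` the sum is at most `(d + 1) * d`, less than the
    -- number `(d + 1) * (d + 1)` of rounds.
    refine (main.sum.resolve_left ?_).1
    have h1 : ∑ i ∈ Finset.range (d + 1), (test.run s).arr 6 i ≤
        ∑ i ∈ Finset.range (d + 1), d := Finset.sum_le_sum fun i hi => by
      have hi' : i ≤ d := by simpa [Nat.lt_succ_iff] using hi
      exact (main.le t' ht' i hi').trans (hle i hi')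
    rw [Finset.sum_const, Finset.card_range, smul_eq_mul] at h1
    nlinarith

end Prog

end Ram

namespace Ram

namespace Prog

open Windows

variable {s σ : State} {n d : ℕ} {S T : Finset ℕ} {lo hi : ℕ → ℕ}

theorem Instance.mem_union (hs : Instance s n d S T lo hi) {u : ℕ} : u ∈ S ∪ T ↔ u < n := by
  have := hs.cover u
  rw [hs.eqS, hs.eqT]
  simp only [supp, Finset.mem_union, Finset.mem_filter, Finset.mem_range]
  tauto

/-! ### Reading the windows from the adjacency matrix -/

/-- Read entry `(reg 5, reg 6)` of the matrix, at address `reg 20`. -/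
def readBody : Prog :=
  load 15 2 20 ;; const 18 1 ;; add 20 20 18 ;;
    cond 15 (load 16 5 5 ;; cond 16 skip (store 4 5 6) ;; add 16 6 18 ;; store 5 5 16) skip

/-- Compute the windows in arrays `4` and `5`. -/
def readWindows : Prog :=
  const 20 0 ;; rep 5 0 (rep 6 1 readBody)

/-- `[l, h)` is the hull of the first `j` entries of the row `E`. -/
def IsHull (E : ℕ → Prop) (l h j : ℕ) : Prop :=
  (h = 0 ∧ ∀ v < j, ¬ E v) ∨
    (l < h ∧ h ≤ j ∧ E l ∧ E (h - 1) ∧ ∀ v < j, E v → l ≤ v ∧ v < h)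

theorem IsHull.succ_of_not {E : ℕ → Prop} {l h j : ℕ} (H : IsHull E l h j) (hj : ¬ E j) :
    IsHull E l h (j + 1) := by
  have key : ∀ v < j + 1, E v → v < j := fun v hv hE => by
    have : v ≠ j := by rintro rfl; exact hj hE
    omega
  rcases H with ⟨h0, H⟩ | ⟨h1, h2, h3, h4, H⟩
  · exact .inl ⟨h0, fun v hv hE => H v (key v hv hE) hE⟩
  · exact .inr ⟨h1, by omega, h3, h4, fun v hv hE => H v (key v hv hE) hE⟩

/-- The value `h = 0` doubles as the flag that no entry has been met, in which case `l` is
meaningless and is set now. -/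
theorem IsHull.succ {E : ℕ → Prop} {l h j : ℕ} (H : IsHull E l h j) (hj : E j) :
    IsHull E (if h = 0 then j else l) (j + 1) (j + 1) := by
  rcases H with ⟨h0, H⟩ | ⟨h1, h2, h3, h4, H⟩
  · rw [if_pos h0]
    refine .inr ⟨by omega, le_rfl, hj, hj, fun v hv hE => ⟨?_, hv⟩⟩
    by_contra hlt
    exact H v (by omega) hE
  · rw [if_neg (by omega)]
    refine .inr ⟨by omega, le_rfl, h3, hj, fun v hv hE => ⟨?_, hv⟩⟩
    by_cases hvj : v = j
    · omega
    · exact (H v (by omega) hE).1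

/-- Convexity turns the hull into the row itself: both extreme entries are present, hence everything
between them. -/
theorem IsHull.mem_iff {E : ℕ → Prop} {l h d : ℕ} (H : IsHull E l h d)
    (hE : ∀ x y z, x ≤ y → y ≤ z → z < d → E x → E z → E y) {v : ℕ} (hv : v < d) :
    E v ↔ l ≤ v ∧ v < h := by
  rcases H with ⟨h0, H⟩ | ⟨h1, h2, h3, h4, H⟩
  · exact ⟨fun h => absurd h (H v hv), fun h => by omega⟩
  · exact ⟨H v hv, fun hw => hE l v (h - 1) hw.1 (by omega) (by omega) h3 h4⟩

theorem IsHull.le {E : ℕ → Prop} {l h d : ℕ} (H : IsHull E l h d) : h ≤ d := by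
  rcases H with ⟨h0, _⟩ | ⟨_, h2, _⟩ <;> omega

theorem readBody_run {k j : ℕ} (h5 : s.reg 5 = k) (h6 : s.reg 6 = j) :
    (readBody.run s).reg 20 = s.reg 20 + 1 ∧
    (readBody.run s).arr 4 = (if s.arr 2 (s.reg 20) ≠ 0 ∧ s.arr 5 k = 0 then
      Function.update (s.arr 4) k j else s.arr 4) ∧
    (readBody.run s).arr 5 = (if s.arr 2 (s.reg 20) ≠ 0 then
      Function.update (s.arr 5) k (j + 1) else s.arr 5) := by
  by_cases hE : s.arr 2 (s.reg 20) = 0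
  · simp [readBody, run, State.setReg, hE]
  · by_cases hh : s.arr 5 k = 0 <;>
      simp [readBody, run, State.setReg, State.setArr, hE, h5, h6, hh]

/-- There is no multiplication, so register 20 carries the row-major address along. Array 5 must
start at zero because zero flags an untouched row. -/
theorem readWindows_run (h0 : s.reg 0 = n) (h1 : s.reg 1 = d) (h5 : ∀ u, s.arr 5 u = 0) :
    ∀ u < n, IsHull (fun v => s.arr 2 (u * d + v) ≠ 0) ((readWindows.run s).arr 4 u)
      ((readWindows.run s).arr 5 u) d := by
  have main := run_rep (i := 5) (b := 0) (p := rep 6 1 readBody) (s := s.setReg 20 0) n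
    (fun k σ => σ.reg 20 = k * d ∧
      (∀ u < k, IsHull (fun v => s.arr 2 (u * d + v) ≠ 0) (σ.arr 4 u) (σ.arr 5 u) d) ∧
      ∀ u, k ≤ u → σ.arr 5 u = 0) rfl h0
    (by rintro k σ x v (rfl | rfl | rfl) h <;> simpa [State.setReg] using h)
    (by simpa [State.setReg] using h5) ?_
  · exact main.2.1
  · intro k hk σ hk5 hr ha ⟨h20, hlt, hge⟩
    have main := run_rep (i := 6) (b := 1) (p := readBody) (s := σ) d
      (fun j τ => τ.reg 20 = k * d + j ∧
        (∀ u < k, IsHull (fun v => s.arr 2 (u * d + v) ≠ 0) (τ.arr 4 u) (τ.arr 5 u) d) ∧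
        IsHull (fun v => s.arr 2 (k * d + v) ≠ 0) (τ.arr 4 k) (τ.arr 5 k) j ∧
        ∀ u, k < u → τ.arr 5 u = 0) rfl ((hr 1 rfl).trans h1)
      (by rintro k σ x v (rfl | rfl | rfl) h <;> simpa [State.setReg] using h)
      ⟨h20, hlt, .inl ⟨hge k le_rfl, by simp⟩, fun u hu => hge u hu.le⟩ ?_
    · refine ⟨by rw [main.1]; ring, fun u hu => ?_, fun u hu => main.2.2.2 u hu⟩
      rcases Nat.lt_succ_iff_lt_or_eq.1 hu with hu | rfl
      · exact main.2.1 u hu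
      · exact main.2.2.1
    · intro j hj τ hj6 hr' ha' ⟨t20, tlt, tk, tgt⟩
      have t5 : τ.reg 5 = k := (hr' 5 rfl).trans hk5
      have a2 : τ.arr 2 = s.arr 2 := (ha' 2 rfl).trans (ha 2 rfl)
      obtain ⟨e20, e4, e5⟩ := readBody_run t5 hj6
      rw [a2, t20] at e4 e5
      have ne : ∀ u, u ≠ k → (readBody.run τ).arr 4 u = τ.arr 4 u ∧
          (readBody.run τ).arr 5 u = τ.arr 5 u := fun u hu => by
        rw [e4, e5]
        constructor <;> split_ifs <;> simp [hu]
      refine ⟨by rw [e20, t20]; ring, fun u hu => ?_, ?_, fun u hu => ?_⟩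
      · rw [(ne u hu.ne).1, (ne u hu.ne).2]
        exact tlt u hu
      · by_cases hE : s.arr 2 (k * d + j) ≠ 0
        · convert tk.succ hE using 1
          · rw [e4]
            by_cases hh : τ.arr 5 k = 0 <;> simp [hE, hh]
          · simp [e5, hE]
        · rw [e4, e5, if_neg hE, if_neg (fun h => hE h.1)]
          exact tk.succ_of_not hE
      · rw [(ne u hu.ne').2]
        exact tgt u hu

/-! ### Narrowing the windows -/

/-- Raise the lower end of window `reg 5` if a schedule remains. -/
def narrowBody : Prog :=
  const 18 1 ;; load 15 4 5 ;; add 15 15 18 ;; store 4 5 15 ;; test ;;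
    cond 17 (const 18 1 ;; load 15 4 5 ;; sub 15 15 18 ;; store 4 5 15) skip

/-- Narrow all windows until the lower ends are a schedule. -/
def narrow : Prog :=
  rep 5 0 (rep 6 1 narrowBody)

theorem narrowBody_run (hs : Instance s n d S T lo hi) (hhi : ∀ u < n, hi u ≤ d) {k : ℕ}
    (h5 : s.reg 5 = k) :
    ((∃ f, IsSchedule (Function.update lo k (lo k + 1)) hi S T f) ∧
      Instance (narrowBody.run s) n d S T (Function.update lo k (lo k + 1)) hi) ∨
    ((¬ ∃ f, IsSchedule (Function.update lo k (lo k + 1)) hi S T f) ∧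
      Instance (narrowBody.run s) n d S T lo hi) := by
  obtain ⟨s1, hs1⟩ : ∃ s1, s1 =
    (const 18 1 ;; load 15 4 5 ;; add 15 15 18 ;; store 4 5 15).run s := ⟨_, rfl⟩
  have e4 := hs.arr4
  have i1 : Instance s1 n d S T (Function.update lo k (lo k + 1)) hi := by
    refine hs.congr (fun x hx => ?_) ?_ ?_ ?_ ?_
    · rw [hs1]; exact run_reg _ s (writesReg_of_wf rfl hx)
    · rw [hs1]; exact run_arr _ s rfl
    · rw [hs1]; exact run_arr _ s rfl
    · rw [hs1]
      simp [run, State.setReg, State.setArr, h5, e4]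
    · rw [hs1, run_arr _ s rfl, hs.arr5]
  have i2 : Instance (test.run s1) n d S T (Function.update lo k (lo k + 1)) hi :=
    i1.run rfl rfl rfl rfl rfl
  have r5 : (test.run s1).reg 5 = k := by
    rw [run_reg test s1 rfl, hs1, run_reg _ s rfl, h5]
  have hrun : narrowBody.run s =
    (cond 17 (const 18 1 ;; load 15 4 5 ;; sub 15 15 18 ;; store 4 5 15) skip).run
      (test.run s1) := by rw [hs1]; rfl
  have htest := test_run i1 hhi
  rw [hrun]
  by_cases h17 : (test.run s1).reg 17 = 0
  · refine .inl ⟨htest.1 h17, ?_⟩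
    have : (cond 17 (const 18 1 ;; load 15 4 5 ;; sub 15 15 18 ;; store 4 5 15) skip).run
      (test.run s1) = test.run s1 := by rw [run, if_neg (by simpa using h17)]; rfl
    rw [this]
    exact i2
  · refine .inr ⟨fun h => h17 (htest.2 h), ?_⟩
    refine i2.congr (fun x hx => run_reg _ _ (writesReg_of_wf rfl hx)) (run_arr _ _ rfl)
      (run_arr _ _ rfl) ?_ ((run_arr _ _ rfl).trans i2.arr5)
    rw [run, if_pos h17]
    simp [run, State.setReg, State.setArr, r5, i2.arr4]

/-- What is known when the windows of the jobs below `k` have been narrowed. -/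
structure NarrowInv (s : State) (n d : ℕ) (S T : Finset ℕ) (lo hi : ℕ → ℕ) (k : ℕ) : Prop where
  inst : Instance s n d S T (s.arr 4) hi
  schedulable : ∃ f, IsSchedule (s.arr 4) hi S T f
  le : ∀ u, lo u ≤ s.arr 4 u
  eq : ∀ f, IsSchedule (s.arr 4) hi S T f → ∀ u < k, f u = s.arr 4 u

theorem NarrowInv.setReg {k x v : ℕ} (h : NarrowInv s n d S T lo hi k) (hx : 3 ≤ x) :
    NarrowInv (s.setReg x v) n d S T lo hi k :=
  ⟨h.inst.run (p := const x v) (by simp [wf, hx]) rfl rfl rfl rfl, h.schedulable, h.le, h.eq⟩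

theorem isSchedule_of_le {lo' : ℕ → ℕ} (hle : ∀ u, lo u ≤ lo' u) {f : ℕ → ℕ}
    (hf : IsSchedule lo' hi S T f) : IsSchedule lo hi S T f :=
  ⟨fun u hu => ⟨(hle u).trans (hf.1 u hu).1, (hf.1 u hu).2⟩, hf.2⟩

/-- When raising the lower end of job `k` destroys all schedules, every schedule places `k` at that
end, and this survives later narrowing since windows only shrink. Finally all jobs are forced, so
the lower ends are themselves a schedule. -/
theorem narrow_run (hs : Instance s n d S T lo hi) (hhi : ∀ u < n, hi u ≤ d)
    (hf : ∃ f, IsSchedule lo hi S T f) : IsSchedule lo hi S T ((narrow.run s).arr 4) := by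
  have main : NarrowInv (narrow.run s) n d S T lo hi n := by
    refine run_rep n (fun k σ => NarrowInv σ n d S T lo hi k) rfl hs.reg0 ?_ ?_ ?_
    · rintro k σ x v hx h
      exact h.setReg (by omega)
    · exact ⟨hs.arr4.symm ▸ hs, hs.arr4.symm ▸ hf, fun u => by rw [hs.arr4], by simp⟩
    · intro k hk σ h5 hr ha hI
      have inner := run_rep (i := 6) (b := 1) (p := narrowBody) (s := σ) d
        (fun j τ => NarrowInv τ n d S T lo hi k ∧
          (j ≤ τ.arr 4 k ∨ ∀ f, IsSchedule (τ.arr 4) hi S T f → f k = τ.arr 4 k)) rfl hI.inst.reg1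
        ?_ ⟨hI, .inl (Nat.zero_le _)⟩ ?_
      · obtain ⟨hJ, hd⟩ := inner
        refine ⟨hJ.inst, hJ.schedulable, hJ.le, fun f hf u hu => ?_⟩
        rcases Nat.lt_succ_iff_lt_or_eq.1 hu with hu | rfl
        · exact hJ.eq f hf u hu
        -- If all `d` attempts had succeeded, the lower end would be at least `d`, leaving no slot
        -- below `hi u ≤ d`.
        · refine hd.resolve_left (fun hd => ?_) f hf
          have := hf.1 u (hJ.inst.mem_union.2 hk)
          have := hhi u hk
          omega
      · rintro j τ x v hx ⟨h1, h2⟩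
        exact ⟨h1.setReg (by omega), h2⟩
      · rintro j hj τ h6 hr' ha' ⟨hJ, hd⟩
        have t5 : τ.reg 5 = k := (hr' 5 rfl).trans h5
        have hle : ∀ u, τ.arr 4 u ≤ Function.update (τ.arr 4) k (τ.arr 4 k + 1) u := fun u => by
          rw [Function.update_apply]; split_ifs with h <;> [subst h; skip] <;> omega
        rcases narrowBody_run hJ.inst hhi t5 with ⟨hf, hi'⟩ | ⟨hf, hi'⟩
        · rw [← hi'.arr4] at hf hle
          refine ⟨⟨hi'.arr4 ▸ hi', hf, fun u => (hJ.le u).trans (hle u), fun f hf u hu => ?_⟩, ?_⟩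
          · rw [hJ.eq f (isSchedule_of_le hle hf) u hu, hi'.arr4]
            simp [hu.ne]
          · have e4 : (narrowBody.run τ).arr 4 k = τ.arr 4 k + 1 := by simp [hi'.arr4]
            rcases hd with hd | hd
            · exact .inl (by omega)
            -- Once job `k` is forced no attempt can succeed: a schedule for the raised window would
            -- place it strictly above its forced slot.
            · obtain ⟨f, hf⟩ := hf
              have h1 := hd f (isSchedule_of_le hle hf)
              have h2 := (hf.1 k (hi'.mem_union.2 hk)).1
              omega
        · rw [hi'.arr4]
          refine ⟨⟨hi'.arr4.symm ▸ hi', hi'.arr4.symm ▸ hJ.schedulable, hi'.arr4.symm ▸ hJ.le,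
            hi'.arr4.symm ▸ hJ.eq⟩, .inr fun f hf' => ?_⟩
          by_contra hne
          refine hf ⟨f, fun u hu => ?_, hf'.2⟩
          have := hf'.1 u hu
          rw [Function.update_apply]
          split_ifs with h
          · subst h; omega
          · exact this
  obtain ⟨f, hf⟩ := main.schedulable
  have heq : ∀ u ∈ S ∪ T, f u = (narrow.run s).arr 4 u := fun u hu =>
    main.eq f hf u (main.inst.mem_union.1 hu)
  have hf' := isSchedule_of_le main.le hf
  refine ⟨fun u hu => heq u hu ▸ hf'.1 u hu, hf'.2.1.congr fun u hu => ?_,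
    hf'.2.2.congr fun u hu => ?_⟩
  · exact heq u (Finset.mem_union_left _ hu)
  · exact heq u (Finset.mem_union_right _ hu)

/-! ### Output -/

/-- Write the edges `(u, arr 4 u)` to array `3`. -/
def writeEdges : Prog :=
  const 18 1 ;; const 20 0 ;; rep 5 0 (load 15 4 5 ;; add 15 20 15 ;; store 3 15 18 ;; add 20 20 1)

theorem writeEdges_run (h0 : s.reg 0 = n) (h1 : s.reg 1 = d) (h3 : ∀ u, s.arr 3 u = 0)
    (h4 : ∀ u < n, s.arr 4 u < d) {u v : ℕ} (hu : u < n) (hv : v < d) :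
    (writeEdges.run s).arr 3 (u * d + v) = 1 ↔ s.arr 4 u = v := by
  have main := run_rep (i := 5) (b := 0)
    (p := load 15 4 5 ;; add 15 20 15 ;; store 3 15 18 ;; add 20 20 1)
    (s := (s.setReg 18 1).setReg 20 0) n (fun k σ => σ.reg 20 = k * d ∧
      ∀ u v, v < d → σ.arr 3 (u * d + v) = if u < k ∧ s.arr 4 u = v then 1 else 0) rfl h0
    (by rintro k σ x v (rfl | rfl | rfl) h <;> simpa [State.setReg] using h)
    (by simp [State.setReg, h3]) ?_
  · have := main.2 u v hv
    simp only [hu, true_and] at this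
    simp only [writeEdges, run] at this ⊢
    rw [this]
    split_ifs with h <;> simp [h]
  · intro k hk σ h5 hr ha ⟨h20, h⟩
    have r18 : σ.reg 18 = 1 := by rw [hr 18 rfl]; simp [State.setReg]
    have r1 : σ.reg 1 = d := by rw [hr 1 rfl]; simpa [State.setReg] using h1
    have a4 : σ.arr 4 = s.arr 4 := ha 4 rfl
    refine ⟨?_, fun u v hv => ?_⟩
    · simp [run, State.setReg, State.setArr, h20, r1, Nat.succ_mul]
    · have hkd := h4 k hk
      -- Row-major addresses do not collide, as both column indices are below `d`.
      have hinj : u * d + v = k * d + s.arr 4 k ↔ u = k ∧ v = s.arr 4 k := by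
        refine ⟨fun he => ?_, by rintro ⟨rfl, rfl⟩; rfl⟩
        have huk : u = k := by
          rcases lt_trichotomy u k with hlt | heq | hlt
          · have := Nat.mul_le_mul_right d (Nat.succ_le_of_lt hlt)
            rw [Nat.succ_mul] at this
            omega
          · exact heq
          · have := Nat.mul_le_mul_right d (Nat.succ_le_of_lt hlt)
            rw [Nat.succ_mul] at this
            omega
        subst huk
        exact ⟨rfl, by omega⟩
      simp [run, State.setReg, State.setArr, Function.update_apply, h20, a4, h5, r18, hinj,
        h u v hv]
      by_cases huk : u = k
      · subst huk
        by_cases hvk : v = s.arr 4 u <;> simp [hvk, eq_comm]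
      · have : u ≤ k ↔ u < k := by omega
        simp [huk, this]

/-! ### The whole program -/

/-- Register `19` receives the answer and array `3` the edges. -/
def solve : Prog :=
  readWindows ;; test ;; cond 17 (const 19 0) (narrow ;; writeEdges ;; const 19 1)

/-- `solve` on an instance whose adjacency matrix has interval rows. -/
theorem solve_run (hs : Instance s n d S T (s.arr 4) (s.arr 5))
    (h3 : ∀ u, s.arr 3 u = 0) (h5 : ∀ u, s.arr 5 u = 0)
    (hE : ∀ u < n, ∀ x y z, x ≤ y → y ≤ z → z < d → s.arr 2 (u * d + x) ≠ 0 →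
      s.arr 2 (u * d + z) ≠ 0 → s.arr 2 (u * d + y) ≠ 0) :
    ∃ lo hi : ℕ → ℕ, (∀ u < n, hi u ≤ d) ∧
      (∀ u < n, ∀ v < d, s.arr 2 (u * d + v) ≠ 0 ↔ lo u ≤ v ∧ v < hi u) ∧
      (((solve.run s).reg 19 = 1 ∧ ∃ f, IsSchedule lo hi S T f ∧
        ∀ u < n, ∀ v < d, (solve.run s).arr 3 (u * d + v) = 1 ↔ f u = v) ∨
      ((solve.run s).reg 19 = 0 ∧ ¬ ∃ f, IsSchedule lo hi S T f)) := by
  have hull := readWindows_run hs.reg0 hs.reg1 h5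
  set s1 := readWindows.run s with hs1
  have hhi : ∀ u < n, s1.arr 5 u ≤ d := fun u hu => (hull u hu).le
  refine ⟨s1.arr 4, s1.arr 5, hhi, fun u hu v hv => (hull u hu).mem_iff (hE u hu) hv, ?_⟩
  have i1 : Instance s1 n d S T (s1.arr 4) (s1.arr 5) :=
    hs.congr (fun x hx => run_reg _ s (writesReg_of_wf rfl hx)) (run_arr _ s rfl)
      (run_arr _ s rfl) rfl rfl
  set s2 := test.run s1 with hs2
  have i2 : Instance s2 n d S T (s1.arr 4) (s1.arr 5) := i1.run rfl rfl rfl rfl rfl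
  have htest : s2.reg 17 = 0 ↔ _ := test_run i1 hhi
  have hrun : solve.run s =
      if s2.reg 17 ≠ 0 then (const 19 0).run s2 else
        (writeEdges.run (narrow.run s2)).setReg 19 1 := rfl
  rw [hrun]
  by_cases h17 : s2.reg 17 = 0
  · rw [if_neg (by simpa using h17)]
    have hsched := narrow_run i2 hhi (htest.1 h17)
    set s3 := narrow.run s2 with hs3
    have hlt : ∀ u < n, s3.arr 4 u < d := fun u hu =>
      (hsched.1 u (i2.mem_union.2 hu)).2.trans_le (hhi u hu)
    have a3 : s3.arr 3 = s.arr 3 := by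
      rw [hs3, run_arr narrow s2 rfl, hs2, run_arr test s1 rfl, hs1, run_arr readWindows s rfl]
    refine .inl ⟨by simp [State.setReg], s3.arr 4, hsched, fun u hu v hv => ?_⟩
    exact writeEdges_run ((run_reg narrow s2 rfl).trans i2.reg0)
      ((run_reg narrow s2 rfl).trans i2.reg1) (by rw [a3]; exact h3) hlt hu hv
  · rw [if_pos h17]
    exact .inr ⟨by simp [run, State.setReg], fun h => h17 (htest.2 h)⟩

/-- Run a program with register `2` set to `reg 1 + 1`, then copy register `19` to register `0`. -/
def wrap (p : Prog) : Cmd :=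
  .seq (.const 3 1) (.seq (.add 2 1 3) (.seq p.toCmd (.seq (.const 3 0) (.add 0 3 19))))

/-- The shift `X + 1` accounts for the bound `d + 1` in register 2, the summand 4 for the
instructions around `p`. The answer reaches register 0 only at the end, because loops are bounded by
it. -/
theorem wrap_exec {p : Prog} (hp : p.wf = true) (s : State) :
    ∃ t ≤ (p.time.comp (Polynomial.X + 1) + 4).eval (s.reg 0 + s.reg 1),
      Exec p.wrap s (((p.run ((s.setReg 3 1).setReg 2 (s.reg 1 + 1))).setReg 3 0).setReg 0
        ((p.run ((s.setReg 3 1).setReg 2 (s.reg 1 + 1))).reg 19)) t := by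
  obtain ⟨t, ht, e⟩ := exec hp (N := s.reg 0 + s.reg 1 + 1)
    ((s.setReg 3 1).setReg 2 (s.reg 1 + 1)) (fun x hx => by
      interval_cases x <;> simp [State.setReg] <;> omega)
  set σ := p.run ((s.setReg 3 1).setReg 2 (s.reg 1 + 1))
  refine ⟨1 + (1 + (t + (1 + 1))), ?_, .seq (.const s 3 1) (.seq (.add (s.setReg 3 1) 2 1 3)
    (.seq e (.seq (.const σ 3 0) ?_)))⟩
  · simp only [Polynomial.eval_add, Polynomial.eval_comp, Polynomial.eval_X, Polynomial.eval_one,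
      Polynomial.eval_ofNat]
    omega
  · convert Exec.add (σ.setReg 3 0) 0 3 19 using 2
    simp [State.setReg]

end Prog

end Ram

/-! ### Simultaneous matchings as schedules -/

namespace OverlappingBipartiteGraph

open Windows

variable {n d : ℕ} {G : OverlappingBipartiteGraph n d} {lo hi : ℕ → ℕ}

theorem mem_S_or_mem_T (G : OverlappingBipartiteGraph n d) (u : Fin n) : u ∈ G.S ∨ u ∈ G.T := by
  rw [← Finset.mem_union, G.union_eq]
  exact Finset.mem_univ u

theorem isMatchingCovering_of_injOn {P : Finset (Fin n)} {M : Finset (Fin n × Fin d)}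
    {f : ℕ → ℕ} (hf : Set.InjOn f (P.image Fin.val)) (hd : ∀ u ∈ P, f u < d)
    (hM : ∀ e, e ∈ M ↔ f e.1 = e.2) :
    IsMatchingCovering (M ∩ (P ×ˢ Finset.univ)) P := by
  refine ⟨fun e he e' he' hne => ?_, fun u hu => ?_⟩
  · simp only [Finset.mem_inter, Finset.mem_product, Finset.mem_univ, and_true, hM] at he he'
    have h1 : e.1 ≠ e'.1 := fun h => hne (Prod.ext h (Fin.ext (by
      rw [← he.1, ← he'.1, h])))
    refine ⟨h1, fun h => h1 (Fin.ext (hf ?_ ?_ ?_))⟩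
    · exact Finset.mem_coe.2 (Finset.mem_image_of_mem _ he.2)
    · exact Finset.mem_coe.2 (Finset.mem_image_of_mem _ he'.2)
    · rw [he.1, he'.1, h]
  · refine ⟨(u, ⟨f u, hd u hu⟩), ⟨?_, rfl⟩, ?_⟩
    · simp only [Finset.mem_inter, Finset.mem_product, Finset.mem_univ, and_true, hM]
      exact ⟨trivial, hu⟩
    · rintro ⟨u', v⟩ ⟨he, rfl⟩
      simp only [Finset.mem_inter, hM] at he
      exact Prod.ext rfl (Fin.ext he.1.symm)

theorem isSimultaneousMatching_of_isSchedule (hhi : ∀ u < n, hi u ≤ d)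
    (hE : ∀ (u : Fin n) (v : Fin d), (u, v) ∈ G.E ↔ lo u ≤ v ∧ (v : ℕ) < hi u) {f : ℕ → ℕ}
    (hf : IsSchedule lo hi (G.S.image Fin.val) (G.T.image Fin.val) f)
    {M : Finset (Fin n × Fin d)} (hM : ∀ e, e ∈ M ↔ f e.1 = e.2) :
    G.IsSimultaneousMatching M := by
  have hw : ∀ u : Fin n, lo u ≤ f u ∧ f u < hi u := fun u => hf.1 u (by
    rw [← Finset.image_union, G.union_eq]
    exact Finset.mem_image_of_mem _ (Finset.mem_univ u))
  have hd : ∀ u : Fin n, f u < d := fun u => (hw u).2.trans_le (hhi u u.2)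
  refine ⟨fun e he => ?_, isMatchingCovering_of_injOn hf.2.1 (fun u _ => hd u) hM,
    isMatchingCovering_of_injOn hf.2.2 (fun u _ => hd u) hM⟩
  have := hw e.1
  rw [(hM e).1 he] at this
  exact (hE e.1 e.2).2 this

theorem IsMatchingCovering.injOn {M : Finset (Fin n × Fin d)} {P : Finset (Fin n)}
    (h : IsMatchingCovering (M ∩ (P ×ˢ Finset.univ)) P) {f : ℕ → ℕ}
    (hf : ∀ u ∈ P, ∃ v : Fin d, f u = v ∧ (u, v) ∈ M) : Set.InjOn f (P.image Fin.val) := by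
  intro x hx y hy hxy
  obtain ⟨u, hu, rfl⟩ := Finset.mem_image.1 (Finset.mem_coe.1 hx)
  obtain ⟨u', hu', rfl⟩ := Finset.mem_image.1 (Finset.mem_coe.1 hy)
  obtain ⟨v, hv, hvM⟩ := hf u hu
  obtain ⟨v', hv', hvM'⟩ := hf u' hu'
  by_contra hne
  refine (h.1 (u, v) (by simp [hvM, hu]) (u', v') (by simp [hvM', hu']) ?_).2 ?_
  · intro he
    exact hne (congrArg (fun e : Fin n × Fin d => (e.1 : ℕ)) he)
  · exact Fin.ext (by rw [← hv, ← hv', hxy])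

/-- Any choice of one edge of `M` at each vertex works: the edge chosen at a vertex of `P` lies in
`M ∩ (P × B)`, for `P = S` and for `P = T`, so the matching property gives injectivity on both. -/
theorem IsSimultaneousMatching.exists_isSchedule
    (hE : ∀ (u : Fin n) (v : Fin d), (u, v) ∈ G.E ↔ lo u ≤ v ∧ (v : ℕ) < hi u)
    {M : Finset (Fin n × Fin d)} (hM : G.IsSimultaneousMatching M) :
    ∃ f, IsSchedule lo hi (G.S.image Fin.val) (G.T.image Fin.val) f := by
  obtain ⟨hME, hS, hT⟩ := hM
  have hex : ∀ u : Fin n, ∃ v : Fin d, (u, v) ∈ M := fun u => by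
    rcases G.mem_S_or_mem_T u with hu | hu
    · obtain ⟨⟨_, v⟩, ⟨he, rfl⟩, _⟩ := hS.2 u hu
      exact ⟨v, (Finset.mem_inter.1 he).1⟩
    · obtain ⟨⟨_, v⟩, ⟨he, rfl⟩, _⟩ := hT.2 u hu
      exact ⟨v, (Finset.mem_inter.1 he).1⟩
  choose g hg using hex
  set f : ℕ → ℕ := fun u => if hu : u < n then g ⟨u, hu⟩ else 0
  have hfg : ∀ u : Fin n, f u = g u := fun u => by simp [f]
  refine ⟨f, fun u hu => ?_, hS.injOn fun u _ => ⟨g u, hfg u, hg u⟩,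
    hT.injOn fun u _ => ⟨g u, hfg u, hg u⟩⟩
  rw [← Finset.image_union] at hu
  obtain ⟨u, _, rfl⟩ := Finset.mem_image.1 hu
  rw [hfg]
  exact (hE u (g u)).1 (hME (hg u))

theorem supp_image (P : Finset (Fin n)) :
    supp n (fun k => if ∃ u ∈ P, (u : ℕ) = k then 1 else 0) = P.image Fin.val := by
  ext k
  simp only [supp, Finset.mem_filter, Finset.mem_range, ne_eq, ite_eq_right_iff,
    one_ne_zero, imp_false, not_not, Finset.mem_image]
  refine ⟨fun h => h.2, fun h => ⟨?_, h⟩⟩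
  obtain ⟨u, _, rfl⟩ := h
  exact u.2

theorem input_arr_two (G : OverlappingBipartiteGraph n d) (u : Fin n) (v : Fin d) :
    G.input.arr 2 ((u : ℕ) * d + v) ≠ 0 ↔ (u, v) ∈ G.E := by
  have : (∃ e ∈ G.E, (e.1 : ℕ) * d + (e.2 : ℕ) = u * d + v) ↔ (u, v) ∈ G.E := by
    refine ⟨?_, fun h => ⟨_, h, rfl⟩⟩
    rintro ⟨⟨u', v'⟩, he, h⟩
    have h2 := congrArg (· % d) h
    have h1 := congrArg (· / d) h
    have hd : 0 < d := v.pos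
    simp only [Nat.mul_add_mod_self_right, Nat.mod_eq_of_lt v.2, Nat.mod_eq_of_lt v'.2] at h2
    rw [mul_comm, mul_comm (u : ℕ)] at h
    simp only [h2, Nat.add_right_cancel_iff] at h
    have h3 : u' = u := Fin.ext (Nat.eq_of_mul_eq_mul_left hd h)
    have h4 : v' = v := Fin.ext h2
    rwa [← h3, ← h4]
  simp only [input, this]
  simp

end OverlappingBipartiteGraph

theorem mainTheorem4 :
    ∃ (prog : Ram.Cmd) (time : Polynomial ℕ),
      ∀ (n d : ℕ) (G : OverlappingBipartiteGraph n d), G.IsConvex →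
        ∃ (s : Ram.State) (t : ℕ),
          Ram.Exec prog G.input s t ∧ t ≤ time.eval (n + d) ∧ G.IsAnswer s := by
  refine ⟨Ram.Prog.solve.wrap, Ram.Prog.solve.time.comp (Polynomial.X + 1) + 4, ?_⟩
  intro n d G hG
  obtain ⟨t, ht, e⟩ := Ram.Prog.wrap_exec (p := Ram.Prog.solve) rfl G.input
  refine ⟨_, t, e, ht, ?_⟩
  obtain ⟨s, hs⟩ : ∃ s, s = (G.input.setReg 3 1).setReg 2 (G.input.reg 1 + 1) := ⟨_, rfl⟩
  have harr : s.arr = G.input.arr := by rw [hs]; rfl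
  have hinst : Ram.Prog.Instance s n d (G.S.image Fin.val) (G.T.image Fin.val)
      (s.arr 4) (s.arr 5) := by
    refine ⟨by rw [hs]; rfl, by rw [hs]; rfl, by rw [hs]; rfl, ?_, ?_, fun u hu => ?_, rfl, rfl⟩
    · rw [harr]; exact (OverlappingBipartiteGraph.supp_image G.S).symm
    · rw [harr]; exact (OverlappingBipartiteGraph.supp_image G.T).symm
    · rw [harr]
      rcases G.mem_S_or_mem_T ⟨u, hu⟩ with h | h
      · have : ∃ w ∈ G.S, (w : ℕ) = u := ⟨_, h, rfl⟩
        exact .inl (by simp [OverlappingBipartiteGraph.input, this])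
      · have : ∃ w ∈ G.T, (w : ℕ) = u := ⟨_, h, rfl⟩
        exact .inr (by simp [OverlappingBipartiteGraph.input, this])
  obtain ⟨lo, hi, hhi, hwin, hcases⟩ := Ram.Prog.solve_run hinst
    -- Arrays 3 and 5 are zero in the input; the remaining obligation is convexity read off the
    -- matrix.
    (fun u => by rw [harr]; rfl) (fun u => by rw [harr]; rfl) (by
      rw [harr]
      intro u hu x y z hxy hyz hz hx hz'
      have hx2 := (G.input_arr_two ⟨u, hu⟩ ⟨x, by omega⟩).1 hx
      have hz2 := (G.input_arr_two ⟨u, hu⟩ ⟨z, hz⟩).1 hz'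
      exact (G.input_arr_two ⟨u, hu⟩ ⟨y, by omega⟩).2
        ((hG ⟨u, hu⟩).out hx2 hz2 ⟨Fin.mk_le_mk.2 hxy, Fin.mk_le_mk.2 hyz⟩))
  have hE : ∀ (u : Fin n) (v : Fin d), (u, v) ∈ G.E ↔ lo u ≤ v ∧ (v : ℕ) < hi u := fun u v => by
    rw [← G.input_arr_two, ← harr]
    exact hwin u u.2 v v.2
  rw [← hs]
  rcases hcases with ⟨h19, f, hf, hout⟩ | ⟨h19, hno⟩
  · refine .inl ⟨by simp [Ram.State.setReg, h19], ?_⟩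
    refine OverlappingBipartiteGraph.isSimultaneousMatching_of_isSchedule hhi hE hf fun e => ?_
    rw [OverlappingBipartiteGraph.outputEdges, Finset.mem_filter]
    exact (and_iff_right (Finset.mem_univ e)).trans (hout e.1 e.1.2 e.2 e.2.2)
  · exact .inr ⟨by simp [Ram.State.setReg, h19], fun ⟨M, hM⟩ => hno (hM.exists_isSchedule hE)⟩
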